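/- All manifolds are real, finite dimensional, Hausdorff, smooth and without boundary; smooth means $C^\infty$. Let $\nu:N\to M$ be a smooth fibre bundle, $\rho:N\to TM$ a smooth map over the identity of $M$ (an anchor map), and $\pi:P\to M$ a smooth principal fibre bundle with structure group $G$, acting from the right by $R_g(u)=ug$. Let $\pi^*N=\{(u,s)\in P\times N:\pi(u)=\nu(s)\}$, with projections $\tilde\pi_1$ onto $P$ and $\tilde\pi_2$ onto $N$, and let $h:\pi^*N\to TP$ be a principal $\rho$-lift, i.e. a smooth map over the identity of $P$ with $TR_g(h(u,s))=h(ug,s)$ and $T\pi(h(u,s))=\rho(s)$. Conventions. A smooth curve $c:[a,b]\to N$, $a<b$ (one that extends smoothly to an open interval containing $[a,b]$), is smooth $\rho$-admissible if $\rho(c(t))$ is the velocity of the base curve $\nu\circ c$ at every $t\in[a,b]$. A $\rho$-admissible curve is a composition of finitely many smooth $\rho$-admissible curves on consecutive intervals whose base curves match at the junctions; at a junction it takes the value of the earlier piece. The $h$-admissible curves in $\pi^*N$, with base curves in $P$, are defined in the same way from the anchored bundle $(\tilde\pi_1,h)$. The distribution generated by an everywhere defined family of local vector fields is the linear span, at each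 point, of their values. Let $Q$ be the distribution on $P$ generated by the fields $h\circ\sigma$, for all smooth local sections $\sigma$ of $\tilde\pi_1$, and $\widetilde Q$ the smallest completely integrable differentiable distribution containing $Q$ (completely integrable: through each point there is a connected immersed submanifold whose tangent spaces are the spaces of the distribution). Theorem. The following hold. 1. The family $\mathcal D^h$ of the lifts $s^h(u)=h(u,s(\pi(u)))$ of the smooth local sections $s$ of $\nu$ is an everywhere defined family of smooth local vector fields on $P$ which generates $Q$; hence a distribution is the smallest completely integrable distribution $\widetilde Q$ containing $Q$ if and only if it is the smallest one containing the distribution generated by $\mathcal D^h$. 2. If $e$ is an $h$-admissible curve, then $\tilde\pi_2\circ e$ is a $\rho$-admissible curve. 3. For every $\rho$-admissible curve $c:[a,b]\to N$ and every $u\in P$ with $\pi(u)=\nu(c(a))$ there is a unique $h$-admissible curve $e:[a,b]\to\pi^*N$ such that $\tilde\pi_2\circ e=c$ and the base curve $\tilde\pi_1\circ e$ is at $u$ for $t=a$. Moreover, let $\omega$ be any principal connection form on $P$ and $\chi=\omega\circ h$. Then there is a unique continuous, piecewise smooth $\omega$-horizontal curve $d^\omega:[a,b]\to P$ with $\pi\circ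 d^\omega=\nu\circ c$ and $d^\omega(a)=u$; there is a unique continuous, piecewise smooth curve $g:[a,b]\to G$ with $g(a)=1$ and $\dot g(t)g(t)^{-1}=\chi(d^\omega(t),c(t))$ (on each of finitely many consecutive intervals, with one-sided derivatives at their end points); and $e(t)=(d^\omega(t)g(t),c(t))$ for all $t\in[a,b]$. -/

import Mathlib

open Set
open scoped Manifold ContDiff RightActions

universe u

namespace AnchoredLift

section Curves

/-- The velocity at `t` of a curve `γ` defined on `s ⊆ ℝ`, as a point of the tangent bundle. At an
endpoint of an interval this is the one-sided velocity. -/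
noncomputable def velocityWithin {E H B : Type*} [NormedAddCommGroup E] [NormedSpace ℝ E]
    [TopologicalSpace H] (I : ModelWithCorners ℝ E H) [TopologicalSpace B] [ChartedSpace H B]
    (γ : ℝ → B) (s : Set ℝ) (t : ℝ) : TangentBundle I B :=
  ⟨γ t, mfderivWithin 𝓘(ℝ, ℝ) I γ s t (1 : ℝ)⟩

/-- Smooth curves on the compact interval `[a, b]`: those which admit a smooth extension to an open
interval containing `[a, b]`. Curves on `[a, b]` are represented by functions on `ℝ` of which only
the restriction to `[a, b]` matters. -/
def IsSmoothCurve {E H Z : Type*} [NormedAddCommGroup E] [NormedSpace ℝ E]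
    [TopologicalSpace H] (J : ModelWithCorners ℝ E H) [TopologicalSpace Z] [ChartedSpace H Z]
    (a b : ℝ) (c : ℝ → Z) : Prop :=
  ∃ ε > 0, ∃ c' : ℝ → Z, ContMDiffOn 𝓘(ℝ, ℝ) J ∞ c' (Ioo (a - ε) (b + ε)) ∧ EqOn c c' (Icc a b)

variable {EB HB B EZ HZ Z : Type*}
  [NormedAddCommGroup EB] [NormedSpace ℝ EB] [TopologicalSpace HB]
  (I : ModelWithCorners ℝ EB HB) [TopologicalSpace B] [ChartedSpace HB B]
  [NormedAddCommGroup EZ] [NormedSpace ℝ EZ] [TopologicalSpace HZ]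
  (J : ModelWithCorners ℝ EZ HZ) [TopologicalSpace Z] [ChartedSpace HZ Z]

/-- Smooth admissible curves `c : [a, b] → S` of an anchored bundle with projection `τ` and anchor
`ρ`: the anchor of `c` is the velocity of the base curve `τ ∘ c`. The total space of the bundle is
an embedded submanifold `S` of the manifold `Z` (`S = univ` if `Z` itself is the total space), so
that a smooth curve in the total space is a smooth curve in `Z` with values in `S`; `τ` and `ρ`
matter on `S` only. -/
structure IsSmoothAdmissible (τ : Z → B) (S : Set Z) (ρ : Z → TangentBundle I B)
    (a b : ℝ) (c : ℝ → Z) : Prop where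
  lt : a < b
  smooth : IsSmoothCurve J a b c
  mem : ∀ t ∈ Icc a b, c t ∈ S
  velocity : ∀ t ∈ Icc a b, ρ (c t) = velocityWithin I (τ ∘ c) (Icc a b) t

/-- (Piecewise) admissible curves: the compositions of finitely many smooth admissible curves whose
consecutive base curves match. At a junction the composition takes the value of the earlier piece
(it may jump there inside a fibre). -/
inductive IsAdmissible (τ : Z → B) (S : Set Z) (ρ : Z → TangentBundle I B) :
    ℝ → ℝ → (ℝ → Z) → Prop
  | smooth {a b : ℝ} {c : ℝ → Z} :
      IsSmoothAdmissible I J τ S ρ a b c → IsAdmissible τ S ρ a b c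
  | comp {a m b : ℝ} {c₁ c₂ c : ℝ → Z} :
      IsAdmissible τ S ρ a m c₁ → IsSmoothAdmissible I J τ S ρ m b c₂ → τ (c₁ m) = τ (c₂ m) →
      EqOn c c₁ (Icc a m) → EqOn c c₂ (Ioc m b) → IsAdmissible τ S ρ a b c

/-- `σ` is a smooth local section on the open set `V` of the bundle `τ` with total space `S`. -/
structure IsLocalSection (τ : Z → B) (S : Set Z) (V : Set B) (σ : B → Z) : Prop where
  isOpen : IsOpen V
  contMDiffOn : ContMDiffOn I J ∞ σ V
  mem : ∀ x ∈ V, σ x ∈ S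
  proj : ∀ x ∈ V, τ (σ x) = x

/-- The family of local vector fields `ρ ∘ σ` on `B` for the local sections `σ` of an anchored
bundle. A local vector field is a pair of its open domain and a map into the tangent bundle, which
matters on the domain only. -/
def anchoredFields (τ : Z → B) (S : Set Z) (ρ : Z → TangentBundle I B) :
    Set (Set B × (B → TangentBundle I B)) :=
  {X | ∃ σ : B → Z, IsLocalSection I J τ S X.1 σ ∧ X.2 = fun x => ρ (σ x)}

end Curves

section Distributions

variable {E H : Type*} {B : Type u}
  [NormedAddCommGroup E] [NormedSpace ℝ E] [TopologicalSpace H]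
  (I : ModelWithCorners ℝ E H) [TopologicalSpace B] [ChartedSpace H B]

/-- The linear span, at every point, of the values of a family of local vector fields. -/
noncomputable def generatedDistribution (𝓕 : Set (Set B × (B → TangentBundle I B))) (x : B) :
    Submodule ℝ (TangentSpace I x) :=
  Submodule.span ℝ {v | ∃ X ∈ 𝓕, x ∈ X.1 ∧ X.2 x = ⟨x, v⟩}

/-- `V` is open and `X` is a smooth vector field on `V`. -/
structure IsLocalField [IsManifold I ∞ B] (V : Set B) (X : B → TangentBundle I B) : Prop where
  isOpen : IsOpen V
  contMDiffOn : ContMDiffOn I I.tangent ∞ X V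
  proj : ∀ x ∈ V, (X x).proj = x

/-- `𝓕` is an everywhere defined family of local smooth vector fields, and it generates the
distribution `D`. -/
structure Generates [IsManifold I ∞ B] (𝓕 : Set (Set B × (B → TangentBundle I B)))
    (D : ∀ x : B, Submodule ℝ (TangentSpace I x)) : Prop where
  isLocalField : ∀ X ∈ 𝓕, IsLocalField I X.1 X.2
  everywhere : ∀ x : B, ∃ X ∈ 𝓕, x ∈ X.1
  eq_span : D = generatedDistribution I 𝓕

/-- Differentiable distributions (not necessarily of constant rank): at every point they are spanned
by the values of smooth local vector fields which take their values in the distribution. -/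
def IsDifferentiable [IsManifold I ∞ B] (D : ∀ x : B, Submodule ℝ (TangentSpace I x)) : Prop :=
  ∀ x : B, D x = generatedDistribution I
    {X | IsLocalField I X.1 X.2 ∧ ∀ y ∈ X.1, (X.2 y).2 ∈ D (X.2 y).1} x

/-- Complete integrability: through every point there is a connected (injectively) immersed
submanifold whose tangent spaces are the spaces of the distribution. -/
def IsCompletelyIntegrable (D : ∀ x : B, Submodule ℝ (TangentSpace I x)) : Prop :=
  ∀ x : B, ∃ (k : ℕ) (L : Type u) (_ : TopologicalSpace L)
    (_ : ChartedSpace (EuclideanSpace ℝ (Fin k)) L) (_ : IsManifold (𝓡 k) ∞ L)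
    (_ : ConnectedSpace L) (i : L → B),
    Function.Injective i ∧ Manifold.IsImmersion (𝓡 k) I ∞ i ∧ x ∈ range i ∧
    ∀ y : L, (mfderiv (𝓡 k) I i y).range = D (i y)

/-- `D'` is the smallest completely integrable (differentiable) distribution containing `D`. -/
def IsSmallestIntegrable [IsManifold I ∞ B] (D D' : ∀ x : B, Submodule ℝ (TangentSpace I x)) :
    Prop :=
  IsLeast {D'' | IsDifferentiable I D'' ∧ IsCompletelyIntegrable I D'' ∧ D ≤ D''} D'

end Distributions

section Bundles

variable {EM HM M EF HF F EN HN N EP HP P EG HG G : Type*}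
  [NormedAddCommGroup EM] [NormedSpace ℝ EM] [TopologicalSpace HM]
  (IM : ModelWithCorners ℝ EM HM) [TopologicalSpace M] [ChartedSpace HM M]
  [NormedAddCommGroup EF] [NormedSpace ℝ EF] [TopologicalSpace HF]
  (IF : ModelWithCorners ℝ EF HF) [TopologicalSpace F] [ChartedSpace HF F]
  [NormedAddCommGroup EN] [NormedSpace ℝ EN] [TopologicalSpace HN]
  (IN : ModelWithCorners ℝ EN HN) [TopologicalSpace N] [ChartedSpace HN N]
  [NormedAddCommGroup EP] [NormedSpace ℝ EP] [TopologicalSpace HP]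
  (IP : ModelWithCorners ℝ EP HP) [TopologicalSpace P] [ChartedSpace HP P]
  [NormedAddCommGroup EG] [NormedSpace ℝ EG] [TopologicalSpace HG]
  (IG : ModelWithCorners ℝ EG HG) [TopologicalSpace G] [ChartedSpace HG G]

/-- A local trivialization which is a diffeomorphism onto its image. -/
def IsSmoothTrivialization {ν : N → M} (e : Bundle.Trivialization F ν) : Prop :=
  ContMDiffOn IN (IM.prod IF) ∞ e e.source ∧
  ContMDiffOn (IM.prod IF) IN ∞ e.toOpenPartialHomeomorph.symm e.target

/-- `ν : N → M` is a smooth fibre bundle with typical fibre `F`. -/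
structure IsFibreBundle (F : Type*) [TopologicalSpace F] [ChartedSpace HF F] (ν : N → M) :
    Prop where
  contMDiff : ContMDiff IN IM ∞ ν
  surjective : Function.Surjective ν
  exists_trivialization : ∀ x : M, ∃ e : Bundle.Trivialization F ν,
    x ∈ e.baseSet ∧ IsSmoothTrivialization IM IF IN e

/-- `ρ : N → TM` is an anchor map for `ν : N → M`: a smooth map over the identity of `M`. -/
structure IsAnchor [IsManifold IM ∞ M] (ν : N → M) (ρ : N → TangentBundle IM M) : Prop where
  contMDiff : ContMDiff IN IM.tangent ∞ ρ
  proj : ∀ s : N, (ρ s).proj = ν s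

/-- `π : P → M` is a smooth principal fibre bundle with structure group `G`, which acts on `P` from
the right, `u <• g` being the action of `g` on `u`. -/
structure IsPrincipalBundle (G : Type*) [TopologicalSpace G] [ChartedSpace HG G] [Group G]
    [MulAction Gᵐᵒᵖ P] (π : P → M) : Prop where
  contMDiff : ContMDiff IP IM ∞ π
  contMDiff_act : ContMDiff (IP.prod IG) IP ∞ fun p : P × G => p.1 <• p.2
  proj_act : ∀ (u : P) (g : G), π (u <• g) = π u
  exists_trivialization : ∀ x : M, ∃ e : Bundle.Trivialization G π,
    x ∈ e.baseSet ∧ IsSmoothTrivialization IM IG IP e ∧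
    ∀ u ∈ e.source, ∀ g : G, e (u <• g) = ((e u).1, (e u).2 * g)

/-- The total space `π^*N ⊆ P × N` of the pull-back bundle. -/
def fibreProduct (π : P → M) (ν : N → M) : Set (P × N) :=
  {p | π p.1 = ν p.2}

/-- `h : π^*N → TP` is a principal lift over the anchor map `ρ`. Values of `h` outside `π^*N` are
irrelevant; as `π^*N` is an embedded submanifold of `P × N`, smoothness of `h` as a map on this
submanifold is smoothness within the set `π^*N`. -/
structure IsPrincipalLift (G : Type*) [Group G] [MulAction Gᵐᵒᵖ P] [IsManifold IP ∞ P]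
    (π : P → M) (ν : N → M) (ρ : N → TangentBundle IM M) (h : P × N → TangentBundle IP P) :
    Prop where
  contMDiffOn : ContMDiffOn (IP.prod IN) IP.tangent ∞ h (fibreProduct π ν)
  proj : ∀ p ∈ fibreProduct π ν, (h p).proj = p.1
  equivariant : ∀ p ∈ fibreProduct π ν, ∀ g : G,
    tangentMap IP IP (fun u : P => u <• g) (h p) = h (p.1 <• g, p.2)
  tangentMap_proj : ∀ p ∈ fibreProduct π ν, tangentMap IP IM π (h p) = ρ p.2

/-- The family of the lifts `u ↦ h (u, s (π u))`, defined on `π⁻¹ U`, of the local sections `s` of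
`ν`, where `U` is the domain of `s`. -/
def liftedFields (π : P → M) (ν : N → M) (h : P × N → TangentBundle IP P) :
    Set (Set P × (P → TangentBundle IP P)) :=
  {X | ∃ (U : Set M) (s : M → N), IsLocalSection IM IN ν univ U s ∧
    X = (π ⁻¹' U, fun u => h (u, s (π u)))}

/-- The form of a standard principal connection on `P`. The Lie algebra `T_1 G` of `G` is the model
space `EG`. The last two conditions are `θ (σ A) = A`, for the fundamental vector fields `σ A`, and
`(R_g)^* θ = Ad_{g⁻¹} θ`, where `Ad_{g⁻¹}` is the derivative at `1` of `x ↦ g⁻¹ x g`. -/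
structure IsConnectionForm [Group G] [MulAction Gᵐᵒᵖ P] [IsManifold IP ∞ P]
    (θ : TangentBundle IP P → EG) : Prop where
  contMDiff : ContMDiff IP.tangent 𝓘(ℝ, EG) ∞ θ
  linear : ∀ u : P, IsLinearMap ℝ fun v : TangentSpace IP u => θ ⟨u, v⟩
  fundamental : ∀ (u : P) (A : EG),
    θ (tangentMap IG IP (fun g : G => u <• g) ⟨1, A⟩) = A
  equivariant : ∀ (g : G) (X : TangentBundle IP P),
    (⟨1, θ (tangentMap IP IP (fun u : P => u <• g) X)⟩ : TangentBundle IG G) =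
      tangentMap IG IG (fun x : G => g⁻¹ * x * g) ⟨1, θ X⟩

/-- `d : [a, b] → P` is a horizontal lift of the curve `γ : [a, b] → M` with respect to the
connection form `θ`: it is continuous and piecewise smooth, its velocity `X` has values in `ker θ`
(that is, `d` is the base curve of an admissible curve `X` of the anchored bundle `ker θ ⊆ TP`,
whose anchor is the inclusion), and it projects onto `γ`. -/
def IsHorizontalLift [IsManifold IP ∞ P] (θ : TangentBundle IP P → EG) (π : P → M) (γ : ℝ → M)
    (a b : ℝ) (d : ℝ → P) : Prop :=
  (∃ X : ℝ → TangentBundle IP P,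
    IsAdmissible IP IP.tangent (fun v : TangentBundle IP P => v.proj) {v | θ v = 0} id a b X ∧
    ∀ t ∈ Icc a b, (X t).proj = d t) ∧
  ∀ t ∈ Icc a b, π (d t) = γ t

/-- `g : [a, b] → G` is a continuous, piecewise smooth solution of `ġ g⁻¹ = Y`, where `Y` is a
piecewise smooth curve in the Lie algebra `EG = T_1 G`: on each piece `ġ = TR_g Y`. -/
def IsRightLogarithmicSolution [Group G] (Y : ℝ → EG) (a b : ℝ) (g : ℝ → G) : Prop :=
  IsAdmissible IG (IG.prod 𝓘(ℝ, EG)) (fun p : G × EG => p.1) univ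
    (fun p => tangentMap IG IG (fun x : G => x * p.1) ⟨1, p.2⟩) a b fun t => (g t, Y t)

end Bundles

end AnchoredLift

/-! The generating families agree pointwise: a point of $\pi^*N$ over $u$ is a pair $(u,n)$, and
local triviality of $\nu$ gives a section $s$ with $s(\nu(n))=n$, so the lift of $s$ takes the value
$h(u,n)$ at $u$. Conversely $u\mapsto(u,s(\pi(u)))$ is a local section of $\tilde\pi_1$. Projection
of admissible curves is functoriality: $\tilde\pi_2$ is a morphism of anchored bundles over $\pi$.

Lifting reduces to an equation in the group. Let $d$ be a smooth curve in $P$ over $\nu\circ c$, and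
let $\dot g=TR_gY$. By the Leibniz rule the velocity of $dg$ is $TR_g(\dot d+Y^\sharp)$, where
$Y^\sharp$ is the fundamental vector of $Y$ at $d$ (`hasVelocity_act`), while equivariance gives
$h(dg,c)=TR_g\,h(d,c)$. So $dg$ lifts $c$ as soon as $h(d,c)-\dot d=Y^\sharp$. The left side is
vertical, because both terms project to $\rho(c)$; hence $Y$ exists, and any linear left inverse of
the infinitesimal action computes it (`vec_eq_add`). The equation for $g$ can be solved over a whole
compact interval, because right translates of solutions are solutions and local solutions can be
matched (`exists_isSmoothRightSolution`).

Two choices of $d$ are used over a trivializing set. The unit section gives the lift without any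
connection, which matters since none is supplied. For a connection form $\omega$, the horizontal
curve $d^\omega$ gives $Y=\chi(d^\omega,c)$; this curve is itself found by correcting the unit
section $q$ with $Y=-\omega(\dot q)$. `induction_of_cover` passes from trivializing sets to
arbitrary admissible curves.

All uniqueness claims rest on one fact: if $\dot y$ is the right translate of $\dot x$ by $x^{-1}y$
off a finite set, then $x^{-1}y$ has velocity zero there and is constant. `eqOn_of_hasVelocity`
carries this to $P$ through the fibre coordinates. The two descriptions of the lift then agree by
uniqueness. -/

namespace AnchoredLift

/-! ### Two-sided velocities of curves -/

section Velocity

variable {EB HB B EC HC C : Type*}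
  [NormedAddCommGroup EB] [NormedSpace ℝ EB] [TopologicalSpace HB]
  {I : ModelWithCorners ℝ EB HB} [TopologicalSpace B] [ChartedSpace HB B]
  [NormedAddCommGroup EC] [NormedSpace ℝ EC] [TopologicalSpace HC]
  {J : ModelWithCorners ℝ EC HC} [TopologicalSpace C] [ChartedSpace HC C]

/-- The curve `γ` is differentiable at `t` with (two-sided) velocity `X`. -/
structure HasVelocity (I : ModelWithCorners ℝ EB HB) (γ : ℝ → B) (t : ℝ)
    (X : TangentBundle I B) : Prop where
  mdifferentiableAt : MDifferentiableAt 𝓘(ℝ, ℝ) I γ t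
  eq : tangentMap 𝓘(ℝ, ℝ) I γ ⟨t, (1 : ℝ)⟩ = X

theorem HasVelocity.proj_eq {γ : ℝ → B} {t : ℝ} {X : TangentBundle I B}
    (h : HasVelocity I γ t X) : X.proj = γ t := by
  rw [← h.eq]; rfl

theorem HasVelocity.unique {γ : ℝ → B} {t : ℝ} {X Y : TangentBundle I B}
    (hX : HasVelocity I γ t X) (hY : HasVelocity I γ t Y) : X = Y :=
  hX.eq.symm.trans hY.eq

theorem _root_.MDifferentiableAt.hasVelocity {γ : ℝ → B} {t : ℝ}
    (h : MDifferentiableAt 𝓘(ℝ, ℝ) I γ t) :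
    HasVelocity I γ t (tangentMap 𝓘(ℝ, ℝ) I γ ⟨t, (1 : ℝ)⟩) :=
  ⟨h, rfl⟩

theorem tangentMap_congr_of_eventuallyEq {f f' : B → C} {X : TangentBundle I B}
    (h : f =ᶠ[nhds X.proj] f') : tangentMap I J f X = tangentMap I J f' X := by
  simp only [tangentMap]
  rw [h.mfderiv_eq, h.eq_of_nhds]

theorem HasVelocity.congr_of_eventuallyEq {γ γ' : ℝ → B} {t : ℝ} {X : TangentBundle I B}
    (h : HasVelocity I γ t X) (h' : γ' =ᶠ[nhds t] γ) : HasVelocity I γ' t X :=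
  ⟨h.mdifferentiableAt.congr_of_eventuallyEq h',
    (tangentMap_congr_of_eventuallyEq h').trans h.eq⟩

theorem HasVelocity.comp {γ : ℝ → B} {t : ℝ} {X : TangentBundle I B} {f : B → C}
    (h : HasVelocity I γ t X) (hf : MDifferentiableAt I J f (γ t)) :
    HasVelocity J (fun s => f (γ s)) t (tangentMap I J f X) := by
  refine ⟨hf.comp t h.mdifferentiableAt, ?_⟩
  rw [← h.eq]
  exact tangentMap_comp_at (⟨t, (1 : ℝ)⟩ : TangentBundle 𝓘(ℝ, ℝ) ℝ) hf h.mdifferentiableAt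

/-- A nondegenerate interval has unique derivatives at every point, so at an end point the one-sided
velocity already determines the two-sided velocity of a differentiable extension. -/
theorem HasVelocity.velocityWithin_eq {γ γ' : ℝ → B} {a b t : ℝ} {X : TangentBundle I B}
    (h : HasVelocity I γ t X) (hab : a < b) (ht : t ∈ Icc a b) (hγ : EqOn γ' γ (Icc a b)) :
    velocityWithin I γ' (Icc a b) t = X := by
  rw [← h.eq]
  simp only [velocityWithin, tangentMap]
  rw [mfderivWithin_congr hγ (hγ ht), mfderivWithin_eq_mfderiv
    (uniqueMDiffWithinAt_iff_uniqueDiffWithinAt.2 (uniqueDiffOn_Icc hab t ht))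
    h.mdifferentiableAt, hγ ht]

end Velocity

/-! ### Admissible curves: composition, morphisms, subdivision -/

section Curves

variable {EB HB B EZ HZ Z : Type*}
  [NormedAddCommGroup EB] [NormedSpace ℝ EB] [TopologicalSpace HB]
  {I : ModelWithCorners ℝ EB HB} [TopologicalSpace B] [ChartedSpace HB B]
  [NormedAddCommGroup EZ] [NormedSpace ℝ EZ] [TopologicalSpace HZ]
  {J : ModelWithCorners ℝ EZ HZ} [TopologicalSpace Z] [ChartedSpace HZ Z]
  {τ : Z → B} {S : Set Z} {ρ : Z → TangentBundle I B} {a b : ℝ} {c : ℝ → Z}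

theorem Ioo_mem_nhds_of_mem_Icc {a b t ε : ℝ} (hε : 0 < ε) (ht : t ∈ Icc a b) :
    Ioo (a - ε) (b + ε) ∈ nhds t :=
  Ioo_mem_nhds (by linarith [ht.1]) (by linarith [ht.2])

theorem IsSmoothCurve.exists_contMDiffAt (h : IsSmoothCurve J a b c) :
    ∃ c' : ℝ → Z, (∀ t ∈ Icc a b, ContMDiffAt 𝓘(ℝ, ℝ) J ∞ c' t) ∧ EqOn c c' (Icc a b) := by
  obtain ⟨ε, hε, c', hc', heq⟩ := h
  exact ⟨c', fun t ht => hc'.contMDiffAt (Ioo_mem_nhds_of_mem_Icc hε ht), heq⟩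

theorem IsSmoothCurve.continuousOn (h : IsSmoothCurve J a b c) : ContinuousOn c (Icc a b) := by
  obtain ⟨c', hc', heq⟩ := h.exists_contMDiffAt
  exact ContinuousOn.congr (fun t ht => (hc' t ht).continuousAt.continuousWithinAt) heq

theorem IsSmoothAdmissible.of_hasVelocity {c' : ℝ → Z} {ε : ℝ} (hab : a < b) (hε : 0 < ε)
    (hc' : ContMDiffOn 𝓘(ℝ, ℝ) J ∞ c' (Ioo (a - ε) (b + ε))) (heq : EqOn c c' (Icc a b))
    (hmem : ∀ t ∈ Icc a b, c' t ∈ S)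
    (hvel : ∀ t ∈ Icc a b, HasVelocity I (fun s => τ (c' s)) t (ρ (c' t))) :
    IsSmoothAdmissible I J τ S ρ a b c where
  lt := hab
  smooth := ⟨ε, hε, c', hc', heq⟩
  mem t ht := heq ht ▸ hmem t ht
  velocity t ht := by
    rw [heq ht]
    exact ((hvel t ht).velocityWithin_eq hab ht fun s hs => congrArg τ (heq hs)).symm

/-- A smooth extension of a smooth admissible curve has the right two-sided velocity on the whole
closed interval. -/
theorem IsSmoothAdmissible.hasVelocity_extension (h : IsSmoothAdmissible I J τ S ρ a b c)
    (hτ : ContMDiff J I ∞ τ) {c' : ℝ → Z} {t : ℝ} (ht : t ∈ Icc a b)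
    (hc' : ContMDiffAt 𝓘(ℝ, ℝ) J ∞ c' t) (heq : EqOn c c' (Icc a b)) :
    HasVelocity I (fun s => τ (c' s)) t (ρ (c' t)) := by
  have hd : MDifferentiableAt 𝓘(ℝ, ℝ) I (fun s => τ (c' s)) t :=
    (hτ.contMDiffAt.comp t hc').mdifferentiableAt (by simp)
  have h2 := hd.hasVelocity.velocityWithin_eq (γ' := τ ∘ c) h.lt ht fun s hs => congrArg τ (heq hs)
  have h3 := h.velocity t ht
  rw [h2, heq ht] at h3
  exact h3 ▸ hd.hasVelocity

theorem IsSmoothAdmissible.hasVelocity (h : IsSmoothAdmissible I J τ S ρ a b c)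
    (hτ : ContMDiff J I ∞ τ) {t : ℝ} (ht : t ∈ Ioo a b) :
    HasVelocity I (fun s => τ (c s)) t (ρ (c t)) := by
  obtain ⟨c', hc', heq⟩ := h.smooth.exists_contMDiffAt
  have ht' := Ioo_subset_Icc_self ht
  rw [heq ht']
  refine (h.hasVelocity_extension hτ ht' (hc' t ht') heq).congr_of_eventuallyEq ?_
  filter_upwards [Icc_mem_nhds ht.1 ht.2] with s hs
  rw [heq hs]

theorem IsSmoothAdmissible.mono (h : IsSmoothAdmissible I J τ S ρ a b c)
    (hτ : ContMDiff J I ∞ τ) {a' b' : ℝ} (ha : a ≤ a') (hb : b' ≤ b) (hab : a' < b') :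
    IsSmoothAdmissible I J τ S ρ a' b' c := by
  obtain ⟨ε, hε, c', hc', heq⟩ := h.smooth
  have hss := Icc_subset_Icc ha hb
  refine .of_hasVelocity hab hε (c' := c')
    (hc'.mono (Ioo_subset_Ioo (by linarith) (by linarith))) (heq.mono hss)
    (fun t ht => heq (hss ht) ▸ h.mem t (hss ht)) fun t ht => ?_
  exact h.hasVelocity_extension hτ (hss ht)
    (hc'.contMDiffAt (Ioo_mem_nhds_of_mem_Icc hε (hss ht))) heq

theorem IsAdmissible.lt (h : IsAdmissible I J τ S ρ a b c) : a < b := by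
  induction h with
  | smooth h => exact h.lt
  | comp _ h₂ _ _ _ ih => exact ih.trans h₂.lt

theorem IsAdmissible.mem (h : IsAdmissible I J τ S ρ a b c) : ∀ t ∈ Icc a b, c t ∈ S := by
  induction h with
  | smooth h => exact h.mem
  | comp h₁ h₂ _ e₁ e₂ ih =>
    intro t ht
    rcases le_or_gt t _ with h | h
    · rw [e₁ ⟨ht.1, h⟩]; exact ih t ⟨ht.1, h⟩
    · rw [e₂ ⟨h, ht.2⟩]; exact h₂.mem t ⟨h.le, ht.2⟩

theorem IsAdmissible.continuousOn (h : IsAdmissible I J τ S ρ a b c) (hτ : Continuous τ) :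
    ContinuousOn (fun t => τ (c t)) (Icc a b) := by
  induction h with
  | smooth h => exact hτ.comp_continuousOn h.smooth.continuousOn
  | @comp m b c₁ c₂ c h₁ h₂ hm e₁ e₂ ih =>
    rw [← Icc_union_Icc_eq_Icc h₁.lt.le h₂.lt.le]
    refine ContinuousOn.union_of_isClosed (ih.congr fun t ht => by simp only [e₁ ht])
      ((hτ.comp_continuousOn h₂.smooth.continuousOn).congr fun t ht => ?_) isClosed_Icc isClosed_Icc
    -- At the junction `c` takes the value of `c₁`, not of `c₂`; only the base points agree there.
    rcases ht.1.eq_or_lt with rfl | h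
    · simp only [Function.comp, e₁ ⟨h₁.lt.le, le_rfl⟩, hm]
    · simp only [Function.comp, e₂ ⟨h, ht.2⟩]

theorem IsAdmissible.exists_finite_hasVelocity (h : IsAdmissible I J τ S ρ a b c)
    (hτ : ContMDiff J I ∞ τ) : ∃ s : Set ℝ, s.Finite ∧
      ∀ t ∈ Ioo a b \ s, HasVelocity I (fun r => τ (c r)) t (ρ (c t)) := by
  induction h with
  | smooth h => exact ⟨∅, finite_empty, fun t ht => h.hasVelocity hτ ht.1⟩
  | @comp m b c₁ c₂ c h₁ h₂ hm e₁ e₂ ih =>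
    obtain ⟨s, hs, H⟩ := ih
    -- The junction is exceptional: the one-sided velocities of the base curve may differ there.
    refine ⟨insert m s, hs.insert m, fun t ht => ?_⟩
    have hts : t ∉ s := fun h => ht.2 (mem_insert_of_mem _ h)
    rcases lt_trichotomy t m with h | rfl | h
    · rw [e₁ ⟨ht.1.1.le, h.le⟩]
      refine (H t ⟨⟨ht.1.1, h⟩, hts⟩).congr_of_eventuallyEq ?_
      filter_upwards [Icc_mem_nhds ht.1.1 h] with r hr
      rw [e₁ hr]
    · exact absurd (mem_insert _ _) ht.2
    · rw [e₂ ⟨h, ht.1.2.le⟩]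
      refine (h₂.hasVelocity hτ ⟨h, ht.1.2⟩).congr_of_eventuallyEq ?_
      filter_upwards [Ioc_mem_nhds h ht.1.2] with r hr
      rw [e₂ hr]

/-- The constructor `comp` only appends a smooth piece on the right; induction on the second curve
reassociates a general composition. -/
theorem IsAdmissible.trans {m : ℝ} {c₁ c₂ : ℝ → Z} (h₁ : IsAdmissible I J τ S ρ a m c₁)
    (h₂ : IsAdmissible I J τ S ρ m b c₂) (hm : τ (c₁ m) = τ (c₂ m))
    (e₁ : EqOn c c₁ (Icc a m)) (e₂ : EqOn c c₂ (Ioc m b)) : IsAdmissible I J τ S ρ a b c := by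
  induction h₂ generalizing c with
  | smooth h₂ => exact .comp h₁ h₂ hm e₁ e₂
  | @comp n b d₁ d₂ d h₂ h₃ hn f₁ f₂ ih =>
    refine .comp (c₁ := c) (ih (hm.trans ?_) e₁ fun t ht => ?_) h₃ ?_ (fun _ _ => rfl)
      fun t ht => ?_
    · rw [f₁ ⟨le_rfl, h₂.lt.le⟩]
    · rw [e₂ ⟨ht.1, ht.2.trans h₃.lt.le⟩, f₁ ⟨ht.1.le, ht.2⟩]
    · rw [e₂ ⟨h₂.lt, h₃.lt.le⟩, f₁ ⟨h₂.lt.le, le_rfl⟩, hn]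
    · rw [e₂ ⟨h₂.lt.trans ht.1, ht.2⟩, f₂ ht]

/-- Concatenation of admissible curves whose base curves match. -/
theorem IsAdmissible.ite {m : ℝ} {c₁ c₂ : ℝ → Z} (h₁ : IsAdmissible I J τ S ρ a m c₁)
    (h₂ : IsAdmissible I J τ S ρ m b c₂) (hm : τ (c₁ m) = τ (c₂ m)) :
    IsAdmissible I J τ S ρ a b fun t => if t ≤ m then c₁ t else c₂ t :=
  h₁.trans h₂ hm (fun _ ht => if_pos ht.2) (fun _ ht => if_neg ht.1.not_ge)

section Map

variable {EC HC C EY HY Y : Type*}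
  [NormedAddCommGroup EC] [NormedSpace ℝ EC] [TopologicalSpace HC]
  {I' : ModelWithCorners ℝ EC HC} [TopologicalSpace C] [ChartedSpace HC C]
  [NormedAddCommGroup EY] [NormedSpace ℝ EY] [TopologicalSpace HY]
  {J' : ModelWithCorners ℝ EY HY} [TopologicalSpace Y] [ChartedSpace HY Y]
  {σ : Y → C} {T : Set Y} {ξ : Y → TangentBundle I' C} {f : B → C} {Φ : Z → Y}

theorem IsSmoothAdmissible.map (h : IsSmoothAdmissible I J τ S ρ a b c) (hτ : ContMDiff J I ∞ τ)
    (hf : ContMDiff I I' ∞ f) (hΦ : ContMDiff J J' ∞ Φ) (hST : MapsTo Φ S T)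
    (hσΦ : ∀ z ∈ S, σ (Φ z) = f (τ z)) (hξ : ∀ z ∈ S, ξ (Φ z) = tangentMap I I' f (ρ z)) :
    IsSmoothAdmissible I' J' σ T ξ a b fun t => Φ (c t) := by
  obtain ⟨ε, hε, c', hc', heq⟩ := h.smooth
  refine ⟨h.lt, ⟨ε, hε, fun t => Φ (c' t), hΦ.comp_contMDiffOn hc',
    fun t ht => congrArg Φ (heq ht)⟩, fun t ht => hST (h.mem t ht), fun t ht => ?_⟩
  have hv := (h.hasVelocity_extension hτ ht
    (hc'.contMDiffAt (Ioo_mem_nhds_of_mem_Icc hε ht)) heq).comp (f := f) (J := I')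
    (hf.mdifferentiable (by simp) _)
  rw [← heq ht, ← hξ _ (h.mem t ht)] at hv
  refine (hv.velocityWithin_eq h.lt ht fun s hs => ?_).symm
  simp only [Function.comp, hσΦ _ (h.mem s hs), ← heq hs]

/-- Admissible curves are mapped to admissible curves by a morphism of anchored bundles. -/
theorem IsAdmissible.map (h : IsAdmissible I J τ S ρ a b c) (hτ : ContMDiff J I ∞ τ)
    (hf : ContMDiff I I' ∞ f) (hΦ : ContMDiff J J' ∞ Φ) (hST : MapsTo Φ S T)
    (hσΦ : ∀ z ∈ S, σ (Φ z) = f (τ z)) (hξ : ∀ z ∈ S, ξ (Φ z) = tangentMap I I' f (ρ z)) :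
    IsAdmissible I' J' σ T ξ a b fun t => Φ (c t) := by
  induction h with
  | smooth h => exact .smooth (h.map hτ hf hΦ hST hσΦ hξ)
  | @comp m b c₁ c₂ c h₁ h₂ hm e₁ e₂ ih =>
    refine .comp ih (h₂.map hτ hf hΦ hST hσΦ hξ) ?_ (fun t ht => congrArg Φ (e₁ ht))
      fun t ht => congrArg Φ (e₂ ht)
    rw [hσΦ _ (h₁.mem m ⟨h₁.lt.le, le_rfl⟩), hσΦ _ (h₂.mem m ⟨le_rfl, h₂.lt.le⟩), hm]

end Map

/-- An induction principle: every admissible curve is a composition of smooth admissible curves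
whose base curves stay in one member of a given family of open sets covering the base. -/
theorem IsAdmissible.induction_of_cover (h : IsAdmissible I J τ S ρ a b c)
    (hτ : ContMDiff J I ∞ τ) {ι : Type*} {U : ι → Set B} (hU : ∀ i, IsOpen (U i))
    (hcov : ∀ x, ∃ i, x ∈ U i) {Q : ℝ → ℝ → (ℝ → Z) → Prop}
    (smooth : ∀ {a b : ℝ} {c : ℝ → Z} (i : ι), IsSmoothAdmissible I J τ S ρ a b c →
      (∀ t ∈ Icc a b, τ (c t) ∈ U i) → Q a b c)
    (comp : ∀ {a m b : ℝ} {c₁ c₂ c : ℝ → Z}, a < m → m < b → Q a m c₁ → Q m b c₂ →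
      τ (c₁ m) = τ (c₂ m) → EqOn c c₁ (Icc a m) → EqOn c c₂ (Ioc m b) → Q a b c) : Q a b c := by
  have key : ∀ {a b : ℝ} {c : ℝ → Z}, IsSmoothAdmissible I J τ S ρ a b c → Q a b c := by
    intro a b c h
    have hcont : Continuous fun t : Icc a b => τ (c t) :=
      (hτ.continuous.comp_continuousOn h.smooth.continuousOn).domRestrict
    obtain ⟨t, ht0, hmono, ⟨m, hm⟩, hsub⟩ := exists_monotone_Icc_subset_open_cover_Icc h.lt.le
      (c := fun i => (fun t : Icc a b => τ (c t)) ⁻¹' U i) (fun i => (hU i).preimage hcont)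
      fun x _ => mem_iUnion.2 (hcov _)
    -- Points of the subdivision may repeat, whereas admissible curves live on nondegenerate
    -- intervals; hence the condition `a < t n`.
    have step : ∀ n, a < t n → Q a (t n) c := by
      intro n
      induction n with
      | zero => rw [ht0]; exact fun h => absurd h (lt_irrefl _)
      | succ n ih =>
        intro hlt
        obtain ⟨i, hi⟩ := hsub n
        have hle : (t n : ℝ) ≤ t (n + 1) := hmono n.le_succ
        rcases hle.eq_or_lt with heq | hlt'
        · rw [← heq] at hlt ⊢; exact ih hlt
        have hQ : Q (t n) (t (n + 1)) c := by
          refine smooth i (h.mono hτ (t n).2.1 (t (n + 1)).2.2 hlt') fun s hs => ?_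
          exact hi (show (⟨s, (t n).2.1.trans hs.1, hs.2.trans (t (n + 1)).2.2⟩ : Icc a b) ∈
            Icc (t n) (t (n + 1)) from hs)
        rcases (t n).2.1.eq_or_lt with heq | hlt''
        · rw [← heq] at hQ; exact hQ
        · exact comp hlt'' hlt' (ih hlt'') hQ rfl (fun _ _ => rfl) fun _ _ => rfl
    have := step m
    rw [hm m le_rfl] at this
    exact this h.lt
  induction h with
  | smooth h => exact key h
  | comp h₁ h₂ hm e₁ e₂ ih => exact comp h₁.lt h₂.lt ih (key h₂) hm e₁ e₂

end Curves

/-! ### Calculus of velocities, and curves with vanishing velocity -/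

section VelocityCalculus

variable {EB HB B EC HC C : Type*}
  [NormedAddCommGroup EB] [NormedSpace ℝ EB] [TopologicalSpace HB]
  {I : ModelWithCorners ℝ EB HB} [TopologicalSpace B] [ChartedSpace HB B]
  [NormedAddCommGroup EC] [NormedSpace ℝ EC] [TopologicalSpace HC]
  {J : ModelWithCorners ℝ EC HC} [TopologicalSpace C] [ChartedSpace HC C]

theorem HasVelocity.prodMk {γ : ℝ → B} {δ : ℝ → C} {t : ℝ} {X : TangentBundle I B}
    {Y : TangentBundle J C} (hX : HasVelocity I γ t X) (hY : HasVelocity J δ t Y) :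
    HasVelocity (I.prod J) (fun s => (γ s, δ s)) t ⟨(X.1, Y.1), (X.2, Y.2)⟩ := by
  refine ⟨hX.mdifferentiableAt.prodMk hY.mdifferentiableAt, ?_⟩
  rw [← hX.eq, ← hY.eq]
  simp only [tangentMap]
  rw [mfderiv_prodMk hX.mdifferentiableAt hY.mdifferentiableAt]
  rfl

theorem hasVelocity_const (x : B) (t : ℝ) : HasVelocity I (fun _ => x) t ⟨x, 0⟩ := by
  refine ⟨mdifferentiableAt_const, ?_⟩
  simp only [tangentMap, mfderiv_const]
  rfl

theorem _root_.HasDerivAt.hasVelocity {x : ℝ → EB} {v : EB} {t : ℝ} (h : HasDerivAt x v t) :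
    HasVelocity 𝓘(ℝ, EB) x t ⟨x t, v⟩ := by
  refine ⟨h.differentiableAt.mdifferentiableAt, ?_⟩
  simp only [tangentMap, mfderiv_eq_fderiv]
  have : fderiv ℝ x t (1 : ℝ) = v := by rw [fderiv_apply_one_eq_deriv, h.deriv]
  exact congrArg (fun w : EB => (⟨x t, w⟩ : TangentBundle 𝓘(ℝ, EB) EB)) this

theorem HasVelocity.hasDerivAt {x : ℝ → EB} {X : TangentBundle 𝓘(ℝ, EB) EB} {t : ℝ}
    (h : HasVelocity 𝓘(ℝ, EB) x t X) : HasDerivAt x X.2 t := by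
  rw [← h.eq]
  have := h.mdifferentiableAt.differentiableAt.hasDerivAt
  simp only [tangentMap, mfderiv_eq_fderiv]
  rwa [← fderiv_apply_one_eq_deriv] at this

variable {E : Type*} [NormedAddCommGroup E] [NormedSpace ℝ E] [CompleteSpace E]
  {M : Type*} [TopologicalSpace M] [T2Space M] [ChartedSpace E M] [IsManifold 𝓘(ℝ, E) ∞ M]

/-- A continuous curve whose velocity vanishes off a finite set is constant. -/
theorem eq_left_of_hasVelocity_zero {γ : ℝ → M} {a b : ℝ} (hγ : ContinuousOn γ (Icc a b))
    {s : Set ℝ} (hs : s.Finite)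
    (h : ∀ t ∈ Ioo a b \ s, HasVelocity 𝓘(ℝ, E) γ t ⟨γ t, 0⟩) {t : ℝ} (ht : t ∈ Icc a b) :
    γ t = γ a := by
  have hclosed : IsClosed ({t | γ t = γ a} ∩ Icc a b) := by
    rw [inter_comm]
    exact hγ.preimage_isClosed_of_isClosed isClosed_Icc isClosed_singleton
  -- Continuous induction: the closed set where `γ` has its initial value can be prolonged to the
  -- right of each of its points, working in one chart.
  refine hclosed.Icc_subset_of_forall_exists_gt (by exact rfl) ?_ ht
  rintro x ⟨hx, hxI⟩ y (hy : x < y)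
  have hxI' : x ∈ Icc a b := Ico_subset_Icc_self hxI
  set φ := extChartAt 𝓘(ℝ, E) (γ x)
  have hev : ∀ᶠ r in nhdsWithin x (Icc a b), γ r ∈ φ.source :=
    hγ x hxI' (extChartAt_source_mem_nhds (I := 𝓘(ℝ, E)) (γ x))
  obtain ⟨δ, hδ, hball⟩ := Metric.mem_nhdsWithin_iff.1 hev
  set z := min (min y b) (x + δ / 2)
  have hxz : x < z := lt_min (lt_min hy hxI.2) (by linarith)
  have hzy : z ≤ y := (min_le_left _ _).trans (min_le_left _ _)
  have hzb : z ≤ b := (min_le_left _ _).trans (min_le_right _ _)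
  have hzδ : z ≤ x + δ / 2 := min_le_right _ _
  have hsub : Icc x z ⊆ Icc a b := Icc_subset_Icc hxI.1 hzb
  have hsrc : ∀ r ∈ Icc x z, γ r ∈ φ.source := fun r hr =>
    hball ⟨by rw [Metric.mem_ball, Real.dist_eq, abs_lt]; constructor <;> linarith [hr.1, hr.2],
      hsub hr⟩
  -- This form of the fundamental theorem of calculus tolerates the exceptional set `s`, given
  -- continuity.
  have hint := MeasureTheory.integral_eq_of_hasDerivAt_off_countable_of_le (fun r => φ (γ r))
    (fun _ => (0 : E)) hxz.le hs.countable
    ((continuousOn_extChartAt (I := 𝓘(ℝ, E)) (γ x)).comp (hγ.mono hsub) hsrc)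
    (fun r hr => by
      have hr' : r ∈ Icc x z := Ioo_subset_Icc_self hr.1
      have hφ : MDifferentiableAt 𝓘(ℝ, E) 𝓘(ℝ, E) φ (γ r) :=
        mdifferentiableAt_extChartAt (by simpa [φ] using hsrc r hr')
      have hv := (h r ⟨⟨hxI.1.trans_lt hr.1.1, hr.1.2.trans_le hzb⟩, hr.2⟩).comp hφ
      have h0 : ((tangentMap 𝓘(ℝ, E) 𝓘(ℝ, E) φ ⟨γ r, 0⟩).2 : E) = 0 :=
        (mfderiv 𝓘(ℝ, E) 𝓘(ℝ, E) φ (γ r)).map_zero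
      exact h0 ▸ hv.hasDerivAt)
    (by simp)
  rw [intervalIntegral.integral_zero, eq_comm, sub_eq_zero] at hint
  have : γ z = γ x := φ.injOn (hsrc z ⟨hxz.le, le_rfl⟩) (hsrc x ⟨le_rfl, hxz.le⟩) hint
  exact ⟨z, this.trans hx, hxz, hzy⟩

end VelocityCalculus

/-! ### The equation `ġ = TR_g Y` on a Lie group -/

section LieGroup

variable {E : Type*} [NormedAddCommGroup E] [NormedSpace ℝ E]
  {G : Type*} [TopologicalSpace G] [ChartedSpace E G] [Group G] [LieGroup 𝓘(ℝ, E) ∞ G]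

theorem mdifferentiableAt_mul_right (k x : G) :
    MDifferentiableAt 𝓘(ℝ, E) 𝓘(ℝ, E) (fun y : G => y * k) x :=
  (contMDiff_mul_right (I := 𝓘(ℝ, E)) (n := ∞)).mdifferentiable (by simp) x

theorem mdifferentiableAt_mul_left (k x : G) :
    MDifferentiableAt 𝓘(ℝ, E) 𝓘(ℝ, E) (fun y : G => k * y) x :=
  (contMDiff_mul_left (I := 𝓘(ℝ, E)) (n := ∞)).mdifferentiable (by simp) x

theorem tangentMap_mul_right_mul_right (k l : G) (X : TangentBundle 𝓘(ℝ, E) G) :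
    tangentMap 𝓘(ℝ, E) 𝓘(ℝ, E) (fun y : G => y * l)
      (tangentMap 𝓘(ℝ, E) 𝓘(ℝ, E) (fun y : G => y * k) X) =
    tangentMap 𝓘(ℝ, E) 𝓘(ℝ, E) (fun y : G => y * (k * l)) X := by
  rw [← tangentMap_comp_at X (mdifferentiableAt_mul_right l _) (mdifferentiableAt_mul_right k _)]
  congr 1
  funext y
  exact mul_assoc y k l

/-- If the velocity of `y` is the right translate of the velocity of `x`, then `x⁻¹ y` has velocity
zero. -/
theorem HasVelocity.inv_mul_zero {x y : ℝ → G} {t : ℝ} {X : TangentBundle 𝓘(ℝ, E) G}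
    (hx : HasVelocity 𝓘(ℝ, E) x t X)
    (hy : HasVelocity 𝓘(ℝ, E) y t
      (tangentMap 𝓘(ℝ, E) 𝓘(ℝ, E) (fun z : G => z * ((x t)⁻¹ * y t)) X)) :
    HasVelocity 𝓘(ℝ, E) (fun s => (x s)⁻¹ * y s) t ⟨(x t)⁻¹ * y t, 0⟩ := by
  have hm : MDifferentiable (𝓘(ℝ, E).prod 𝓘(ℝ, E)) 𝓘(ℝ, E) (fun p : G × G => p.1⁻¹ * p.2) :=
    (contMDiff_fst.inv.mul contMDiff_snd :
      ContMDiff (𝓘(ℝ, E).prod 𝓘(ℝ, E)) 𝓘(ℝ, E) ∞ _).mdifferentiable (by simp)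
  have h1 := (hx.prodMk hy).comp (f := fun p : G × G => p.1⁻¹ * p.2) (hm _)
  -- Compare with the curve where `k = (x t)⁻¹ * y t` is frozen: the pairs `(x, y)` and `(x, x * k)`
  -- have the same velocity at `t`, and the second is sent by `p.1⁻¹ * p.2` to the constant `k`.
  have h2 := (hx.prodMk (hx.comp (mdifferentiableAt_mul_right ((x t)⁻¹ * y t) _))).comp
    (f := fun p : G × G => p.1⁻¹ * p.2) (hm _)
  simp only [inv_mul_cancel_left] at h2
  rw [h2.unique (hasVelocity_const _ _)] at h1
  exact h1

/-- `g` is a smooth solution of `ġ = TR_g Y` at all points of `s`. -/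
def IsSmoothRightSolution (Y : ℝ → E) (s : Set ℝ) (g : ℝ → G) : Prop :=
  ∀ t ∈ s, ContMDiffAt 𝓘(ℝ, ℝ) 𝓘(ℝ, E) ∞ g t ∧
    HasVelocity 𝓘(ℝ, E) g t (tangentMap 𝓘(ℝ, E) 𝓘(ℝ, E) (fun x : G => x * g t) ⟨1, Y t⟩)

/-- The right-invariance of the equation, which lets solutions be matched at a point and given any
initial value. -/
theorem IsSmoothRightSolution.mul_const {Y : ℝ → E} {s : Set ℝ} {g : ℝ → G}
    (h : IsSmoothRightSolution Y s g) (k : G) : IsSmoothRightSolution Y s fun t => g t * k := by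
  intro t ht
  refine ⟨(h t ht).1.mul contMDiffAt_const, ?_⟩
  have := (h t ht).2.comp (mdifferentiableAt_mul_right k (g t))
  rwa [tangentMap_mul_right_mul_right] at this

variable [CompleteSpace E]

/-- Uniqueness of curves in `G` up to a constant left factor determined by the initial values. -/
theorem inv_mul_eq_of_hasVelocity [T2Space G] {x y : ℝ → G} {a b : ℝ}
    (hx : ContinuousOn x (Icc a b)) (hy : ContinuousOn y (Icc a b)) {s : Set ℝ} (hs : s.Finite)
    (h : ∀ t ∈ Ioo a b \ s, ∃ X, HasVelocity 𝓘(ℝ, E) x t X ∧ HasVelocity 𝓘(ℝ, E) y t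
      (tangentMap 𝓘(ℝ, E) 𝓘(ℝ, E) (fun z : G => z * ((x t)⁻¹ * y t)) X)) {t : ℝ}
    (ht : t ∈ Icc a b) : (x t)⁻¹ * y t = (x a)⁻¹ * y a := by
  have : IsTopologicalGroup G := topologicalGroup_of_lieGroup 𝓘(ℝ, E) ∞
  refine eq_left_of_hasVelocity_zero (E := E) (γ := fun t => (x t)⁻¹ * y t) (hx.inv.mul hy) hs
    (fun t ht => ?_) ht
  obtain ⟨X, h1, h2⟩ := h t ht
  exact h1.inv_mul_zero h2

/-- Translating `g₂` by `k` matches the values at `m`. By uniqueness the two solutions then agree on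
a neighbourhood of `m`, not just at `m`, so the concatenation is smooth there. -/
theorem IsSmoothRightSolution.glue [T2Space G] {Y : ℝ → E} {a₁ b₁ a₂ b₂ m : ℝ} {g₁ g₂ : ℝ → G}
    (h₁ : IsSmoothRightSolution Y (Ioo a₁ b₁) g₁) (h₂ : IsSmoothRightSolution Y (Ioo a₂ b₂) g₂)
    (hm₁ : m ∈ Ioo a₁ b₁) (hm₂ : m ∈ Ioo a₂ b₂) :
    ∃ g : ℝ → G, IsSmoothRightSolution Y (Ioo a₁ b₂) g := by
  set k := (g₂ m)⁻¹ * g₁ m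
  have h₂' := h₂.mul_const k
  have hmem : Ioo a₁ b₁ ∩ Ioo a₂ b₂ ∈ nhds m :=
    Filter.inter_mem (Ioo_mem_nhds hm₁.1 hm₁.2) (Ioo_mem_nhds hm₂.1 hm₂.2)
  obtain ⟨δ, hδ, hsub⟩ := Metric.nhds_basis_closedBall.mem_iff.1 hmem
  rw [Real.closedBall_eq_Icc] at hsub
  have hagree : ∀ t ∈ Icc (m - δ) (m + δ), g₁ t = g₂ t * k := by
    have hk : ∀ t ∈ Icc (m - δ) (m + δ), (g₁ t)⁻¹ * (g₂ t * k) =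
        (g₁ (m - δ))⁻¹ * (g₂ (m - δ) * k) := fun t ht =>
      inv_mul_eq_of_hasVelocity (E := E) (s := ∅)
        (fun t ht => (h₁ t (hsub ht).1).1.continuousAt.continuousWithinAt)
        (fun t ht => (h₂' t (hsub ht).2).1.continuousAt.continuousWithinAt) finite_empty
        (fun t ht => by
          have ht' := hsub (Ioo_subset_Icc_self ht.1)
          refine ⟨_, (h₁ t ht'.1).2, ?_⟩
          rw [tangentMap_mul_right_mul_right, mul_inv_cancel_left]
          exact (h₂' t ht'.2).2) ht
    intro t ht
    -- The constant is expressed by the left end point `m - δ`; evaluation at `m` shows that it is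
    -- `1`.
    have hm := hk m ⟨by linarith, by linarith⟩
    rw [mul_inv_cancel_left, inv_mul_cancel] at hm
    exact (inv_mul_eq_one.1 ((hk t ht).trans hm.symm))
  refine ⟨fun t => if t ≤ m then g₁ t else g₂ t * k, fun t ht => ?_⟩
  rcases lt_trichotomy t m with hlt | rfl | hlt
  · have hev : (fun t => if t ≤ m then g₁ t else g₂ t * k) =ᶠ[nhds t] g₁ := by
      filter_upwards [Iio_mem_nhds hlt] with s hs using if_pos (le_of_lt hs)
    have := h₁ t ⟨ht.1, hlt.trans hm₁.2⟩
    refine ⟨this.1.congr_of_eventuallyEq hev, ?_⟩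
    simp only [hlt.le, if_true]
    exact this.2.congr_of_eventuallyEq hev
  · have hev : (fun s => if s ≤ t then g₁ s else g₂ s * k) =ᶠ[nhds t] g₁ := by
      filter_upwards [Icc_mem_nhds (sub_lt_self t hδ) (lt_add_of_pos_right t hδ)] with s hs
      split_ifs
      · rfl
      · exact (hagree s hs).symm
    have := h₁ t hm₁
    refine ⟨this.1.congr_of_eventuallyEq hev, ?_⟩
    simp only [le_refl, if_true]
    exact this.2.congr_of_eventuallyEq hev
  · have hev : (fun t => if t ≤ m then g₁ t else g₂ t * k) =ᶠ[nhds t] fun t => g₂ t * k := by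
      filter_upwards [Ioi_mem_nhds hlt] with s hs using if_neg (not_le_of_gt hs)
    have := h₂' t ⟨hm₂.1.trans hlt, ht.2⟩
    refine ⟨this.1.congr_of_eventuallyEq hev, ?_⟩
    simp only [hlt.not_ge, if_false]
    exact this.2.congr_of_eventuallyEq hev

/-- In a chart at `1`, with multiplication `Ψ`, the equation reads `x' = F t x`, where `F t x` is
the partial derivative of `Ψ` in its first variable at the unit, applied to the chart image of `Y
t`. Starting at the unit keeps a short solution in the chart. -/
theorem exists_isSmoothRightSolution_nhds {Y : ℝ → E} {α β t₀ : ℝ}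
    (hY : ContDiffOn ℝ ∞ Y (Ioo α β)) (ht₀ : t₀ ∈ Ioo α β) :
    ∃ δ > 0, ∃ g : ℝ → G, IsSmoothRightSolution Y (Ioo (t₀ - δ) (t₀ + δ)) g := by
  have : IsTopologicalGroup G := topologicalGroup_of_lieGroup 𝓘(ℝ, E) ∞
  set φ := extChartAt 𝓘(ℝ, E) (1 : G)
  set x₁ := φ 1 with hx₁
  have hφ1 : φ.symm x₁ = 1 := extChartAt_to_inv (I := 𝓘(ℝ, E)) (1 : G)
  have hx₁t : x₁ ∈ φ.target := mem_extChartAt_target (I := 𝓘(ℝ, E)) (1 : G)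
  have htgt : IsOpen φ.target := isOpen_extChartAt_target (I := 𝓘(ℝ, E)) (1 : G)
  have hsrc : IsOpen φ.source := isOpen_extChartAt_source (I := 𝓘(ℝ, E)) (1 : G)
  have hsymm : ∀ x ∈ φ.target, ContMDiffAt 𝓘(ℝ, E) 𝓘(ℝ, E) ∞ φ.symm x := fun x hx =>
    (contMDiffOn_extChartAt_symm (1 : G)).contMDiffAt (htgt.mem_nhds hx)
  have hφs : ∀ x ∈ φ.source, ContMDiffAt 𝓘(ℝ, E) 𝓘(ℝ, E) ∞ φ x := fun x hx =>
    contMDiffAt_extChartAt' (by simpa [φ] using hx)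
  -- the multiplication of `G` in the chart at `1`
  set Ψ : E × E → E := fun p => φ (φ.symm p.1 * φ.symm p.2) with hΨ
  have hΨs : ∀ p : E × E, p.1 ∈ φ.target → p.2 ∈ φ.target → φ.symm p.1 * φ.symm p.2 ∈ φ.source →
      ContDiffAt ℝ ∞ Ψ p := by
    intro p h1 h2 h3
    rw [← contMDiffAt_iff_contDiffAt]
    exact (hφs _ h3).comp p (((hsymm _ h1).comp p contDiff_fst.contMDiff.contMDiffAt).mul
      ((hsymm _ h2).comp p contDiff_snd.contMDiff.contMDiffAt))
  set A : E →L[ℝ] E := mfderiv 𝓘(ℝ, E) 𝓘(ℝ, E) φ (1 : G)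
  set F : ℝ → E → E := fun t x => fderiv ℝ Ψ (x₁, x) (A (Y t), 0)
  have hone : ∀ x ∈ φ.target, φ.symm x₁ * φ.symm x ∈ φ.source := fun x hx => by
    rw [hφ1, one_mul]; exact φ.map_target hx
  have hFs : ∀ t ∈ Ioo α β, ∀ x ∈ φ.target, ContDiffAt ℝ ∞ (Function.uncurry F) (t, x) := by
    intro t ht x hx
    have h1 : ContDiffAt ℝ ∞ (fun p : ℝ × E => fderiv ℝ Ψ (x₁, p.2)) (t, x) :=
      ((hΨs (x₁, x) hx₁t hx (hone x hx)).fderiv_right (m := ∞) (by simp)).comp (t, x)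
        (contDiffAt_const.prodMk contDiffAt_snd)
    have h2 : ContDiffAt ℝ ∞ (fun p : ℝ × E => (A (Y p.1), (0 : E))) (t, x) :=
      (A.contDiff.contDiffAt.comp (t, x) (((hY t ht).contDiffAt (isOpen_Ioo.mem_nhds ht)).comp
        (t, x) contDiffAt_fst)).prodMk contDiffAt_const
    exact h1.clm_apply h2
  -- Time is added as a coordinate of speed `1` to make the equation autonomous; `hc1` checks that
  -- this coordinate is indeed `t`.
  obtain ⟨c, hc0, ε, hε, hc⟩ :=
    ContDiffAt.exists_forall_mem_closedBall_exists_eq_forall_mem_Ioo_hasDerivAt₀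
    (f := fun p : ℝ × E => ((1 : ℝ), F p.1 p.2)) (x₀ := (t₀, x₁))
    (contDiffAt_const.prodMk ((hFs t₀ ht₀ x₁ hx₁t).of_le (by simp))) t₀
  have hc1 : ∀ t ∈ Ioo (t₀ - ε) (t₀ + ε), (c t).1 = t := by
    intro t ht
    have hd : ∀ s ∈ Ioo (t₀ - ε) (t₀ + ε), HasDerivAt (fun s => (c s).1 - s) 0 s := fun s hs => by
      have h1 : HasDerivAt (fun s => (c s).1) 1 s :=
        (ContinuousLinearMap.fst ℝ ℝ E).hasFDerivAt.comp_hasDerivAt s (hc s hs)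
      exact (h1.sub (hasDerivAt_id' s)).congr_deriv (sub_self _)
    have := isOpen_Ioo.is_const_of_deriv_eq_zero isPreconnected_Ioo
      (fun s hs => (hd s hs).differentiableAt.differentiableWithinAt)
      (fun s hs => (hd s hs).deriv) ht (show t₀ ∈ Ioo (t₀ - ε) (t₀ + ε) by constructor <;> linarith)
    simp only [hc0, sub_self] at this
    linarith
  have hct : ContinuousAt c t₀ := (hc t₀ (by constructor <;> linarith)).continuousAt
  have hnhds : ∀ᶠ t in nhds t₀, t ∈ Ioo (t₀ - ε) (t₀ + ε) ∧ t ∈ Ioo α β ∧ (c t).2 ∈ φ.target :=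
    (isOpen_Ioo.eventually_mem ⟨by linarith, by linarith⟩).and ((isOpen_Ioo.eventually_mem ht₀).and
      (hct.snd.eventually (by simp only [hc0]; exact htgt.mem_nhds hx₁t)))
  obtain ⟨δ, hδ, hsub⟩ := Metric.nhds_basis_closedBall.mem_iff.1 hnhds
  rw [Real.closedBall_eq_Icc] at hsub
  set x : ℝ → E := fun t => (c t).2
  have hx : ∀ t ∈ Icc (t₀ - δ) (t₀ + δ), HasDerivAt x (F t (x t)) t := fun t ht => by
    have : HasDerivAt x (F (c t).1 (c t).2) t :=
      (ContinuousLinearMap.snd ℝ ℝ E).hasFDerivAt.comp_hasDerivAt t (hc t (hsub ht).1)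
    rwa [hc1 t (hsub ht).1] at this
  -- So far `x` is only known to be differentiable; smoothness of `F` bootstraps it to a smooth
  -- curve.
  have hxs : ContDiffOn ℝ ∞ x (Icc (t₀ - δ) (t₀ + δ)) :=
    ODE.contDiffOn_enat_Icc_of_hasDerivWithinAt (n := ⊤) (f := F) (u := φ.target)
      (fun p hp => (hFs p.1 (hsub hp.1).2.1 p.2 hp.2).contDiffWithinAt)
      (fun t ht => (hx t ht).hasDerivWithinAt) fun t ht => (hsub ht).2.2
  refine ⟨δ, hδ, fun t => φ.symm (x t), fun t ht => ?_⟩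
  have ht' := Ioo_subset_Icc_self ht
  have hxt : x t ∈ φ.target := (hsub ht').2.2
  refine ⟨(hsymm _ hxt).comp t (hxs.contDiffAt (Icc_mem_nhds ht.1 ht.2)).contMDiffAt, ?_⟩
  have hv := (hx t ht').hasVelocity.comp ((hsymm _ hxt).mdifferentiableAt (by simp))
  suffices h : tangentMap 𝓘(ℝ, E) 𝓘(ℝ, E) (fun y : G => y * φ.symm (x t)) ⟨1, Y t⟩ =
      tangentMap 𝓘(ℝ, E) 𝓘(ℝ, E) φ.symm ⟨x t, F t (x t)⟩ by rwa [h]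
  set k := φ.symm (x t) with hk
  have hΨd := (hΨs (x₁, x t) hx₁t hxt (hone _ hxt)).differentiableAt (by simp)
  have hΨd' : HasFDerivAt (fun z => Ψ (z, x t))
      ((fderiv ℝ Ψ (x₁, x t)).comp (ContinuousLinearMap.inl ℝ E E)) x₁ :=
    HasFDerivAt.comp (g := Ψ) (f := fun z => (z, x t)) x₁ hΨd.hasFDerivAt
      (hasFDerivAt_prodMk_left (𝕜 := ℝ) x₁ (x t))
  have hΨ1 : Ψ (x₁, x t) = x t := by simp only [hΨ, hφ1, one_mul, φ.right_inv hxt]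
  -- Near `1`, right translation by `k` factors through the chart; the chain rule then identifies
  -- its derivative with `F`.
  have hloc : (fun y : G => y * k) =ᶠ[nhds 1] fun y => φ.symm (Ψ (φ y, x t)) := by
    have h1 : ∀ᶠ y : G in nhds 1, y ∈ φ.source :=
      hsrc.mem_nhds (mem_extChartAt_source (I := 𝓘(ℝ, E)) (1 : G))
    have h2 : ∀ᶠ y : G in nhds 1, y * k ∈ φ.source :=
      (continuous_mul_const k).continuousAt.eventually
        (hsrc.mem_nhds (by simp only [one_mul]; exact φ.map_target hxt))
    filter_upwards [h1, h2] with y hy1 hy2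
    simp only [hΨ, φ.left_inv hy1, ← hk, φ.left_inv hy2]
  have hφd : MDifferentiableAt 𝓘(ℝ, E) 𝓘(ℝ, E) φ (1 : G) :=
    (hφs 1 (mem_extChartAt_source (I := 𝓘(ℝ, E)) (1 : G))).mdifferentiableAt (by simp)
  have hΨm : MDifferentiableAt 𝓘(ℝ, E) 𝓘(ℝ, E) (fun z => Ψ (z, x t)) (φ 1) :=
    hΨd'.differentiableAt.mdifferentiableAt
  have hsd : MDifferentiableAt 𝓘(ℝ, E) 𝓘(ℝ, E) φ.symm (Ψ (φ 1, x t)) := by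
    rw [← hx₁, hΨ1]; exact (hsymm _ hxt).mdifferentiableAt (by simp)
  rw [tangentMap_congr_of_eventuallyEq hloc]
  have e1 := tangentMap_comp_at (⟨1, Y t⟩ : TangentBundle 𝓘(ℝ, E) G)
    (g := fun z => φ.symm (Ψ (z, x t))) (f := φ)
    (MDifferentiableAt.comp (f := fun z => Ψ (z, x t)) _ hsd hΨm) hφd
  have e2 := tangentMap_comp_at (tangentMap 𝓘(ℝ, E) 𝓘(ℝ, E) φ (⟨1, Y t⟩ : TangentBundle 𝓘(ℝ, E) G))
    (g := φ.symm) (f := fun z => Ψ (z, x t)) hsd hΨm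
  refine e1.trans (e2.trans (congrArg _ ?_))
  simp only [tangentMap, mfderiv_eq_fderiv]
  rw [← hx₁, hΨd'.fderiv, hΨ1]
  rfl

/-- Existence of a smooth solution of `ġ = TR_g Y` on a neighbourhood of a compact interval. -/
theorem exists_isSmoothRightSolution [T2Space G] {Y : ℝ → E} {α β a b : ℝ}
    (hY : ContDiffOn ℝ ∞ Y (Ioo α β)) (ha : α < a) (hab : a ≤ b) (hb : b < β) (k : G) :
    ∃ ε > 0, ∃ g : ℝ → G, IsSmoothRightSolution Y (Ioo (a - ε) (b + ε)) g ∧ g a = k := by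
  have hsub : Icc a b ⊆ Ioo α β := fun t ht => ⟨ha.trans_le ht.1, ht.2.trans_lt hb⟩
  choose δ hδ g hg using fun t : Icc a b =>
    exists_isSmoothRightSolution_nhds (G := G) hY (hsub t.2)
  obtain ⟨t, ht0, hmono, ⟨m, hm⟩, hcov⟩ := exists_monotone_Icc_subset_open_cover_Icc hab
    (c := fun i : Icc a b => ((↑) : Icc a b → ℝ) ⁻¹' Ioo (i - δ i) (i + δ i))
    (fun i => isOpen_Ioo.preimage continuous_subtype_val)
    fun x _ => mem_iUnion.2 ⟨x, show (x : ℝ) ∈ Ioo _ _ from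
      ⟨by linarith [hδ x], by linarith [hδ x]⟩⟩
  have step : ∀ n, ∃ ε > 0, ∃ g : ℝ → G, IsSmoothRightSolution Y (Ioo (a - ε) (t n + ε)) g := by
    intro n
    induction n with
    | zero => rw [ht0]; exact ⟨_, hδ ⟨a, le_rfl, hab⟩, _, hg ⟨a, le_rfl, hab⟩⟩
    | succ n ih =>
      obtain ⟨ε, hε, g₁, hg₁⟩ := ih
      obtain ⟨i, hi⟩ := hcov n
      have hle : t n ≤ t (n + 1) := hmono n.le_succ
      have h1 : (t n : ℝ) ∈ Ioo (i - δ i : ℝ) (i + δ i) := hi ⟨le_rfl, hle⟩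
      have h2 : (t (n + 1) : ℝ) ∈ Ioo (i - δ i : ℝ) (i + δ i) := hi ⟨hle, le_rfl⟩
      obtain ⟨g₃, hg₃⟩ := hg₁.glue (m := t n) (hg i)
        ⟨by linarith [(t n).2.1], by linarith⟩ h1
      refine ⟨min ε (i + δ i - t (n + 1)), lt_min hε (by linarith [h2.2]), g₃,
        fun s hs => hg₃ s ⟨?_, ?_⟩⟩
      · linarith [hs.1, min_le_left ε (i + δ i - t (n + 1))]
      · linarith [hs.2, min_le_right ε (i + δ i - t (n + 1))]
  obtain ⟨ε, hε, g, hg⟩ := step m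
  rw [hm m le_rfl] at hg
  -- The initial value was not tracked through the gluing; a right translation adjusts it.
  exact ⟨ε, hε, fun t => g t * ((g a)⁻¹ * k), hg.mul_const _, mul_inv_cancel_left _ _⟩

end LieGroup

section TangentVectors

variable {E M : Type*} [NormedAddCommGroup E] [NormedSpace ℝ E] [TopologicalSpace M]
  [ChartedSpace E M]

/-- The vector part of a point of the tangent bundle, as an element of the model space. -/
def vec (X : TangentBundle 𝓘(ℝ, E) M) : E := X.2

/-- Serves to compare vectors over points that are equal but not definitionally so, such as `u <• 1`
and `u`. -/
theorem ext_vec {X Y : TangentBundle 𝓘(ℝ, E) M} (h : X.proj = Y.proj) (h' : vec X = vec Y) :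
    X = Y := by
  obtain ⟨x, v⟩ := X
  obtain ⟨y, w⟩ := Y
  obtain rfl : x = y := h
  exact congrArg _ h'

end TangentVectors

/-! ### Principal bundles: Leibniz rule, vertical vectors, uniqueness of curves -/

section PrincipalBundle

variable {EM EP EG EQ HQ M P G Q : Type*}
  [NormedAddCommGroup EM] [NormedSpace ℝ EM] [NormedAddCommGroup EP] [NormedSpace ℝ EP]
  [NormedAddCommGroup EG] [NormedSpace ℝ EG]
  [NormedAddCommGroup EQ] [NormedSpace ℝ EQ] [TopologicalSpace HQ] {J : ModelWithCorners ℝ EQ HQ}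
  [TopologicalSpace Q] [ChartedSpace HQ Q]
  [TopologicalSpace M] [ChartedSpace EM M]
  [TopologicalSpace P] [ChartedSpace EP P]
  [TopologicalSpace G] [ChartedSpace EG G] [Group G]
  [MulAction Gᵐᵒᵖ P] {π : P → M}

omit [TopologicalSpace P] [TopologicalSpace G] in
theorem act_act (u : P) (g k : G) : (u <• g) <• k = u <• (g * k) := by
  rw [MulOpposite.op_mul, mul_smul]

omit [TopologicalSpace P] [TopologicalSpace G] in
theorem act_one (u : P) : u <• (1 : G) = u := by
  rw [MulOpposite.op_one, one_smul]

namespace IsPrincipalBundle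

variable (hπ : IsPrincipalBundle 𝓘(ℝ, EM) 𝓘(ℝ, EP) 𝓘(ℝ, EG) G π)

include hπ

theorem contMDiff_act_right (g : G) : ContMDiff 𝓘(ℝ, EP) 𝓘(ℝ, EP) ∞ fun u : P => u <• g :=
  hπ.contMDiff_act.comp (contMDiff_id.prodMk contMDiff_const)

theorem contMDiff_orbit (u : P) : ContMDiff 𝓘(ℝ, EG) 𝓘(ℝ, EP) ∞ fun g : G => u <• g :=
  hπ.contMDiff_act.comp (contMDiff_const.prodMk contMDiff_id)

theorem mdifferentiableAt_act_right (g : G) (u : P) :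
    MDifferentiableAt 𝓘(ℝ, EP) 𝓘(ℝ, EP) (fun u : P => u <• g) u :=
  (hπ.contMDiff_act_right g).mdifferentiable (by simp) u

theorem mdifferentiableAt_orbit (u : P) (g : G) :
    MDifferentiableAt 𝓘(ℝ, EG) 𝓘(ℝ, EP) (fun g : G => u <• g) g :=
  (hπ.contMDiff_orbit u).mdifferentiable (by simp) g

theorem mdifferentiableAt_proj (u : P) : MDifferentiableAt 𝓘(ℝ, EP) 𝓘(ℝ, EM) π u :=
  hπ.contMDiff.mdifferentiable (by simp) u

/-- The Leibniz rule for the right action. -/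
theorem mfderiv_act {f : Q → P} {k : Q → G} {x : Q} {u : P} {g : G} (hu : f x = u) (hg : k x = g)
    (hf : MDifferentiableAt J 𝓘(ℝ, EP) f x) (hk : MDifferentiableAt J 𝓘(ℝ, EG) k x)
    (v : TangentSpace J x) :
    (mfderiv J 𝓘(ℝ, EP) (fun y => f y <• k y) x v : EP) =
      (mfderiv 𝓘(ℝ, EP) 𝓘(ℝ, EP) (fun u : P => u <• g) u (mfderiv J 𝓘(ℝ, EP) f x v) : EP) +
      (mfderiv 𝓘(ℝ, EG) 𝓘(ℝ, EP) (fun g : G => u <• g) g (mfderiv J 𝓘(ℝ, EG) k x v) : EP) := by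
  subst hu hg
  have hm : MDifferentiableAt (𝓘(ℝ, EP).prod 𝓘(ℝ, EG)) 𝓘(ℝ, EP) (fun p : P × G => p.1 <• p.2)
    (f x, k x) := hπ.contMDiff_act.mdifferentiable (by simp) _
  have h1 : mfderiv J 𝓘(ℝ, EP) (fun y => f y <• k y) x v = _ :=
    congrArg (fun L => L v) (mfderiv_comp x (g := fun p : P × G => p.1 <• p.2) hm (hf.prodMk hk))
  rw [mfderiv_prodMk hf hk] at h1
  exact h1.trans (mfderiv_prod_eq_add_apply hm)

variable [LieGroup 𝓘(ℝ, EG) ∞ G]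

/-- A curve in a principal bundle multiplied with a curve in the group. -/
theorem hasVelocity_act {d : ℝ → P} {g : ℝ → G} {t : ℝ} {X Z : TangentBundle 𝓘(ℝ, EP) P} {y : EG}
    (hd : HasVelocity 𝓘(ℝ, EP) d t X)
    (hg : HasVelocity 𝓘(ℝ, EG) g t (tangentMap 𝓘(ℝ, EG) 𝓘(ℝ, EG) (fun x : G => x * g t) ⟨1, y⟩))
    (hZ : Z.proj = d t)
    (hZX : vec Z = vec X + vec (tangentMap 𝓘(ℝ, EG) 𝓘(ℝ, EP) (fun x : G => d t <• x) ⟨1, y⟩)) :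
    HasVelocity 𝓘(ℝ, EP) (fun s => d s <• g s) t
      (tangentMap 𝓘(ℝ, EP) 𝓘(ℝ, EP) (fun u : P => u <• g t) Z) := by
  have hm := (hπ.contMDiff_act.mdifferentiable (by simp) (d t, g t)).comp t
    (hd.mdifferentiableAt.prodMk hg.mdifferentiableAt)
  refine ⟨hm, ?_⟩
  obtain ⟨z, w⟩ := Z
  obtain rfl : z = d t := hZ
  -- Both sides differentiate `x ↦ d t <• (x * g t) = (d t <• x) <• g t` at `1`, so the group term
  -- of the Leibniz rule is also an image under `TR_g`.
  have hL : tangentMap 𝓘(ℝ, EG) 𝓘(ℝ, EP) (fun x : G => d t <• x)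
      (tangentMap 𝓘(ℝ, ℝ) 𝓘(ℝ, EG) g ⟨t, (1 : ℝ)⟩) =
      tangentMap 𝓘(ℝ, EP) 𝓘(ℝ, EP) (fun u : P => u <• g t)
        (tangentMap 𝓘(ℝ, EG) 𝓘(ℝ, EP) (fun x : G => d t <• x) ⟨1, y⟩) := by
    rw [hg.eq, ← tangentMap_comp_at _ (hπ.mdifferentiableAt_orbit _ _)
      (mdifferentiableAt_mul_right (g t) _), ← tangentMap_comp_at _
      (hπ.mdifferentiableAt_act_right _ _) (hπ.mdifferentiableAt_orbit _ _)]
    congr 1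
    funext x
    exact (act_act _ _ _).symm
  have hone : tangentMap 𝓘(ℝ, EG) 𝓘(ℝ, EP) (fun x : G => d t <• x) ⟨1, y⟩ =
      (⟨d t, vec (E := EP) (tangentMap 𝓘(ℝ, EG) 𝓘(ℝ, EP) (fun x : G => d t <• x) ⟨1, y⟩)⟩ :
        TangentBundle 𝓘(ℝ, EP) P) :=
    ext_vec (act_one (d t)) rfl
  rw [hone] at hL
  have hL' := congrArg vec hL
  refine ext_vec rfl ?_
  refine (hπ.mfderiv_act rfl rfl hd.mdifferentiableAt hg.mdifferentiableAt (1 : ℝ)).trans ?_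
  have hX : vec X = mfderiv 𝓘(ℝ, ℝ) 𝓘(ℝ, EP) d t (1 : ℝ) := by rw [← hd.eq]; rfl
  rw [hX] at hZX
  let L : EP →L[ℝ] EP := mfderiv 𝓘(ℝ, EP) 𝓘(ℝ, EP) (fun u : P => u <• g t) (d t)
  exact (congrArg (fun w : EP => L (mfderiv 𝓘(ℝ, ℝ) 𝓘(ℝ, EP) d t (1 : ℝ)) + w) hL').trans
    ((L.map_add _ _).symm.trans (congrArg L hZX.symm))

end IsPrincipalBundle

/-- A local trivialization of a principal bundle: smooth and equivariant. -/
structure IsPrincipalTrivialization (e : Bundle.Trivialization G π) : Prop where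
  smooth : IsSmoothTrivialization 𝓘(ℝ, EM) 𝓘(ℝ, EG) 𝓘(ℝ, EP) e
  equivariant : ∀ u ∈ e.source, ∀ g : G, e (u <• g) = ((e u).1, (e u).2 * g)

namespace IsPrincipalTrivialization

variable {e : Bundle.Trivialization G π}
  (he : IsPrincipalTrivialization (EM := EM) (EP := EP) (EG := EG) e)

include he

theorem contMDiffAt_snd {u : P} (hu : π u ∈ e.baseSet) :
    ContMDiffAt 𝓘(ℝ, EP) 𝓘(ℝ, EG) ∞ (fun u => (e u).2) u :=
  _root_.contMDiffAt_snd.comp u (he.smooth.1.contMDiffAt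
    (e.open_source.mem_nhds (e.mem_source.2 hu)))

theorem mdifferentiableAt_snd {u : P} (hu : π u ∈ e.baseSet) :
    MDifferentiableAt 𝓘(ℝ, EP) 𝓘(ℝ, EG) (fun u => (e u).2) u :=
  (he.contMDiffAt_snd hu).mdifferentiableAt (by simp)

theorem snd_act {u : P} (hu : π u ∈ e.baseSet) (g : G) : (e (u <• g)).2 = (e u).2 * g := by
  rw [he.equivariant u (e.mem_source.2 hu)]

theorem contMDiffAt_symm (g : G) {x : M} (hx : x ∈ e.baseSet) :
    ContMDiffAt 𝓘(ℝ, EM) 𝓘(ℝ, EP) ∞ (fun x => e.toOpenPartialHomeomorph.symm (x, g)) x :=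
  (he.smooth.2.contMDiffAt (e.open_target.mem_nhds (e.mem_target.2 hx))).comp x
    (f := fun x => (x, g)) (contMDiffAt_id.prodMk contMDiffAt_const)

omit [Group G] [MulAction Gᵐᵒᵖ P] he in
theorem injOn_snd {u v : P} (hu : π u ∈ e.baseSet) (huv : π u = π v) (h : (e u).2 = (e v).2) :
    u = v := by
  have hv : π v ∈ e.baseSet := huv ▸ hu
  refine e.injOn (e.mem_source.2 hu) (e.mem_source.2 hv) (Prod.ext ?_ h)
  exact (e.coe_fst' hu).trans (huv.trans (e.coe_fst' hv).symm)

theorem symm_act (hπ : IsPrincipalBundle 𝓘(ℝ, EM) 𝓘(ℝ, EP) 𝓘(ℝ, EG) G π) {x : M}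
    (hx : x ∈ e.baseSet) (g k : G) :
    e.toOpenPartialHomeomorph.symm (x, g) <• k = e.toOpenPartialHomeomorph.symm (x, g * k) := by
  have h1 := e.proj_symm_apply' (x := g) hx
  have h2 := e.proj_symm_apply' (x := g * k) hx
  refine injOn_snd (e := e) ?_ ?_ ?_
  · rw [hπ.proj_act, h1]; exact hx
  · rw [hπ.proj_act, h1, h2]
  · rw [he.snd_act (by rwa [h1]), e.apply_symm_apply' hx, e.apply_symm_apply' hx]

/-- The trivialization recovers the element of the Lie algebra from a vertical vector at a point of
the unit section. -/
theorem tangentMap_snd_orbit (hπ : IsPrincipalBundle 𝓘(ℝ, EM) 𝓘(ℝ, EP) 𝓘(ℝ, EG) G π) {u : P}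
    (hu : π u ∈ e.baseSet) (hu1 : (e u).2 = 1) (B : EG) :
    tangentMap 𝓘(ℝ, EP) 𝓘(ℝ, EG) (fun u => (e u).2)
      (tangentMap 𝓘(ℝ, EG) 𝓘(ℝ, EP) (fun g : G => u <• g) ⟨1, B⟩) = ⟨1, B⟩ := by
  have hu' : π (u <• (1 : G)) ∈ e.baseSet := by rwa [act_one]
  rw [← tangentMap_comp_at (⟨1, B⟩ : TangentBundle 𝓘(ℝ, EG) G) (he.mdifferentiableAt_snd hu')
    (hπ.mdifferentiableAt_orbit u 1)]
  have : (fun u => (e u).2) ∘ (fun g : G => u <• g) = id := by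
    funext g
    simp only [Function.comp, he.snd_act hu, hu1, one_mul, id]
  rw [this, tangentMap_id]
  rfl

end IsPrincipalTrivialization

namespace IsPrincipalBundle

variable (hπ : IsPrincipalBundle 𝓘(ℝ, EM) 𝓘(ℝ, EP) 𝓘(ℝ, EG) G π)

include hπ

theorem exists_principalTrivialization (x : M) : ∃ e : Bundle.Trivialization G π,
    x ∈ e.baseSet ∧ IsPrincipalTrivialization (EM := EM) (EP := EP) (EG := EG) e := by
  obtain ⟨e, hx, h1, h2⟩ := hπ.exists_trivialization x
  exact ⟨e, hx, h1, h2⟩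

variable [LieGroup 𝓘(ℝ, EG) ∞ G]

/-- Vertical tangent vectors are values of fundamental vector fields. -/
theorem exists_eq_tangentMap_orbit {X : TangentBundle 𝓘(ℝ, EP) P}
    (hX : vec (tangentMap 𝓘(ℝ, EP) 𝓘(ℝ, EM) π X) = 0) :
    ∃ B : EG, X = tangentMap 𝓘(ℝ, EG) 𝓘(ℝ, EP) (fun g : G => X.proj <• g) ⟨1, B⟩ := by
  obtain ⟨u, v⟩ := X
  obtain ⟨e, hu, he⟩ := hπ.exists_principalTrivialization (π u)
  set x := (e u).2
  -- Near `u` one has `w = f w <• k w`, with `f` factoring through `π`. In the derivative of this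
  -- identity the `f` term vanishes on vertical vectors, which leaves the orbit term.
  set f : P → P := fun w => e.toOpenPartialHomeomorph.symm (π w, x)
  set k : P → G := fun w => x⁻¹ * (e w).2
  have hfu : f u = u := e.symm_apply_mk_proj (e.mem_source.2 hu)
  have hku : k u = 1 := inv_mul_cancel _
  have hs : MDifferentiableAt 𝓘(ℝ, EM) 𝓘(ℝ, EP)
      (fun y => e.toOpenPartialHomeomorph.symm (y, x)) (π u) :=
    (he.contMDiffAt_symm x hu).mdifferentiableAt (by simp)
  have hf : MDifferentiableAt 𝓘(ℝ, EP) 𝓘(ℝ, EP) f u := hs.comp u (hπ.mdifferentiableAt_proj u)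
  have hk : MDifferentiableAt 𝓘(ℝ, EP) 𝓘(ℝ, EG) k u :=
    (mdifferentiableAt_mul_left x⁻¹ _).comp u (he.mdifferentiableAt_snd hu)
  have hid : (fun w => f w <• k w) =ᶠ[nhds u] id := by
    filter_upwards [(hπ.contMDiff.continuous.isOpen_preimage _ e.open_baseSet).mem_nhds hu]
      with w hw
    simp only [f, k, he.symm_act hπ hw, mul_inv_cancel_left]
    exact e.symm_apply_mk_proj (e.mem_source.2 hw)
  have h := hπ.mfderiv_act hfu hku hf hk v
  have hf0 : (mfderiv 𝓘(ℝ, EP) 𝓘(ℝ, EP) f u v : EP) = 0 := by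
    have h1 : (mfderiv 𝓘(ℝ, EP) 𝓘(ℝ, EP) f u v : EP) =
        mfderiv 𝓘(ℝ, EM) 𝓘(ℝ, EP) (fun y => e.toOpenPartialHomeomorph.symm (y, x)) (π u)
          (mfderiv 𝓘(ℝ, EP) 𝓘(ℝ, EM) π u v) :=
      congrArg (fun L => L v) (mfderiv_comp u hs (hπ.mdifferentiableAt_proj u))
    have h2 : mfderiv 𝓘(ℝ, EP) 𝓘(ℝ, EM) π u v = 0 := hX
    rw [h1, h2]
    exact ContinuousLinearMap.map_zero _
  refine ⟨mfderiv 𝓘(ℝ, EP) 𝓘(ℝ, EG) k u v, ext_vec (act_one u).symm ?_⟩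
  rw [hid.mfderiv_eq, mfderiv_id] at h
  refine Eq.trans h ?_
  let L : EP →L[ℝ] EP := mfderiv 𝓘(ℝ, EP) 𝓘(ℝ, EP) (fun w : P => w <• (1 : G)) u
  have h3 : L (mfderiv 𝓘(ℝ, EP) 𝓘(ℝ, EP) f u v : EP) = 0 := 
    (congrArg L hf0).trans L.map_zero
  exact (congrArg (fun w : EP => w + _) h3).trans (zero_add _)

/-- Curves with the same projection whose velocities correspond under the right action agree if
their initial values do. -/
theorem eqOn_of_hasVelocity [CompleteSpace EG] [T2Space G] [T2Space P] {d d' : ℝ → P} {a b : ℝ}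
    (hd : ContinuousOn d (Icc a b)) (hd' : ContinuousOn d' (Icc a b))
    (hbase : ∀ t ∈ Icc a b, π (d' t) = π (d t)) {s : Set ℝ} (hs : s.Finite)
    (h : ∀ t ∈ Ioo a b \ s, ∃ X, HasVelocity 𝓘(ℝ, EP) d t X ∧ ∀ k : G, d' t = d t <• k →
      HasVelocity 𝓘(ℝ, EP) d' t (tangentMap 𝓘(ℝ, EP) 𝓘(ℝ, EP) (fun u : P => u <• k) X))
    (ha : d' a = d a) : EqOn d' d (Icc a b) := by
  have hclosed : IsClosed ({t | d' t = d t} ∩ Icc a b) := by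
    have := (hd'.prodMk hd).preimage_isClosed_of_isClosed isClosed_Icc isClosed_diagonal
    rw [inter_comm]
    exact this
  refine hclosed.Icc_subset_of_forall_exists_gt ha ?_
  rintro x ⟨hx : d' x = d x, hxI⟩ y (hy : x < y)
  have hxI' : x ∈ Icc a b := Ico_subset_Icc_self hxI
  obtain ⟨e, hxe, he⟩ := hπ.exists_principalTrivialization (π (d x))
  have hev : ∀ᶠ r in nhdsWithin x (Icc a b), π (d r) ∈ e.baseSet :=
    (hπ.contMDiff.continuous.comp_continuousOn hd) x hxI' (e.open_baseSet.mem_nhds hxe)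
  obtain ⟨δ, hδ, hball⟩ := Metric.mem_nhdsWithin_iff.1 hev
  set z := min (min y b) (x + δ / 2)
  have hxz : x < z := lt_min (lt_min hy hxI.2) (by linarith)
  have hzy : z ≤ y := (min_le_left _ _).trans (min_le_left _ _)
  have hzb : z ≤ b := (min_le_left _ _).trans (min_le_right _ _)
  have hzδ : z ≤ x + δ / 2 := min_le_right _ _
  have hsub : Icc x z ⊆ Icc a b := Icc_subset_Icc hxI.1 hzb
  have hsrc : ∀ r ∈ Icc x z, π (d r) ∈ e.baseSet := fun r hr =>
    hball ⟨by rw [Metric.mem_ball, Real.dist_eq, abs_lt]; constructor <;> linarith [hr.1, hr.2],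
      hsub hr⟩
  have hsrc' : ∀ r ∈ Icc x z, π (d' r) ∈ e.baseSet := fun r hr => hbase r (hsub hr) ▸ hsrc r hr
  -- On `[x, z]` both curves lie in one trivialization. Their fibre coordinates inherit the
  -- correspondence of velocities under right translation by `k`, so their quotient is constant.
  have key := inv_mul_eq_of_hasVelocity (E := EG) (x := fun r => (e (d r)).2)
    (y := fun r => (e (d' r)).2) (a := x) (b := z)
    (fun r hr => (he.contMDiffAt_snd (hsrc r hr)).continuousAt.comp_continuousWithinAt
      (hd.mono hsub r hr))
    (fun r hr => (he.contMDiffAt_snd (hsrc' r hr)).continuousAt.comp_continuousWithinAt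
      (hd'.mono hsub r hr)) hs
    (fun r hr => by
      have hr' : r ∈ Icc x z := Ioo_subset_Icc_self hr.1
      obtain ⟨X, hX, hX'⟩ := h r ⟨⟨hxI.1.trans_lt hr.1.1, hr.1.2.trans_le hzb⟩, hr.2⟩
      refine ⟨_, hX.comp (he.mdifferentiableAt_snd (hsrc r hr')), ?_⟩
      set k := ((e (d r)).2)⁻¹ * (e (d' r)).2
      have hk : d' r = d r <• k := by
        refine IsPrincipalTrivialization.injOn_snd (e := e) (hsrc' r hr') ?_ ?_
        · rw [hπ.proj_act, hbase r (hsub hr')]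
        · rw [he.snd_act (hsrc r hr'), mul_inv_cancel_left]
      have hv := (hX' k hk).comp (he.mdifferentiableAt_snd (hsrc' r hr'))
      have hXd := hX.proj_eq
      rw [← tangentMap_comp_at _ (mdifferentiableAt_mul_right k _)
        (by rw [hXd]; exact he.mdifferentiableAt_snd (hsrc r hr'))]
      rw [← tangentMap_comp_at _ (by rw [hXd, ← hk]; exact he.mdifferentiableAt_snd (hsrc' r hr'))
        (hπ.mdifferentiableAt_act_right k _)] at hv
      convert hv using 1
      refine tangentMap_congr_of_eventuallyEq ?_
      rw [hXd]
      filter_upwards [(hπ.contMDiff.continuous.isOpen_preimage _ e.open_baseSet).mem_nhds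
        (hsrc r hr')] with u hu
      exact (he.snd_act hu k).symm) (t := z) ⟨hxz.le, le_rfl⟩
  simp only [hx, inv_mul_cancel] at key
  refine ⟨z, ?_, hxz, hzy⟩
  exact IsPrincipalTrivialization.injOn_snd (e := e) (hsrc' z ⟨hxz.le, le_rfl⟩)
    (hbase z (hsub ⟨hxz.le, le_rfl⟩)) (inv_mul_eq_one.1 key).symm

end IsPrincipalBundle

end PrincipalBundle

theorem exists_Ioo_subset_of_Icc_subset {a b : ℝ} (hab : a ≤ b) {U : Set ℝ} (hU : IsOpen U)
    (h : Icc a b ⊆ U) : ∃ ε > 0, Ioo (a - ε) (b + ε) ⊆ U := by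
  obtain ⟨δ₁, h₁, H₁⟩ := Metric.isOpen_iff.1 hU a (h ⟨le_rfl, hab⟩)
  obtain ⟨δ₂, h₂, H₂⟩ := Metric.isOpen_iff.1 hU b (h ⟨hab, le_rfl⟩)
  rw [Real.ball_eq_Ioo] at H₁ H₂
  refine ⟨min δ₁ δ₂, lt_min h₁ h₂, fun t ht => ?_⟩
  have m1 := min_le_left δ₁ δ₂
  have m2 := min_le_right δ₁ δ₂
  rcases lt_or_ge t a with hta | hta
  · exact H₁ ⟨by linarith [ht.1], by linarith⟩
  rcases le_or_gt t b with htb | htb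
  · exact h ⟨hta, htb⟩
  · exact H₂ ⟨by linarith, by linarith [ht.2]⟩

/-! ### Smooth curves of tangent vectors -/

section TangentBundle

variable {E E' M M' : Type*} [NormedAddCommGroup E] [NormedSpace ℝ E]
  [NormedAddCommGroup E'] [NormedSpace ℝ E']
  [TopologicalSpace M] [ChartedSpace E M] [IsManifold 𝓘(ℝ, E) ∞ M]
  [TopologicalSpace M'] [ChartedSpace E' M'] [IsManifold 𝓘(ℝ, E') ∞ M']

/-- In general `vec` reads each fibre in its own preferred chart and need not be smooth. Over a
fixed `x` it is the fibre coordinate of the trivialization at `x`. -/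
theorem contDiffOn_vec_of_proj_eq {K : ℝ → TangentBundle 𝓘(ℝ, E) M} {s : Set ℝ} {x : M}
    (hK : ContMDiffOn 𝓘(ℝ, ℝ) 𝓘(ℝ, E).tangent ∞ K s) (hx : ∀ t ∈ s, (K t).proj = x) :
    ContDiffOn ℝ ∞ (fun t => vec (K t)) s := by
  intro t ht
  have h := (Bundle.contMDiffWithinAt_totalSpace.1 (hK t ht)).2
  rw [hx t ht] at h
  have hfix : ∀ r ∈ s, vec (K r) = (trivializationAt E (TangentSpace 𝓘(ℝ, E)) x (K r)).2 := by
    intro r hr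
    have hKr : K r = ⟨x, vec (E := E) (K r)⟩ := ext_vec (hx r hr) rfl
    conv_rhs => rw [hKr]
    exact ((tangentBundleCore 𝓘(ℝ, E) M).coordChange_self (achart E x) x
      (mem_chart_source E x) (vec (K r))).symm
  exact (contMDiffWithinAt_iff_contDiffWithinAt.1 h).congr hfix (hfix t ht)

theorem contMDiffOn_tangentMap_comp {f : M → M'} {U : Set M} (hU : IsOpen U)
    (hf : ContMDiffOn 𝓘(ℝ, E) 𝓘(ℝ, E') ∞ f U) {K : ℝ → TangentBundle 𝓘(ℝ, E) M} {s : Set ℝ}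
    (hK : ContMDiffOn 𝓘(ℝ, ℝ) 𝓘(ℝ, E).tangent ∞ K s) (hKU : ∀ t ∈ s, (K t).proj ∈ U) :
    ContMDiffOn 𝓘(ℝ, ℝ) 𝓘(ℝ, E').tangent ∞
      (fun t => tangentMap 𝓘(ℝ, E) 𝓘(ℝ, E') f (K t)) s := by
  refine ((hf.contMDiffOn_tangentMapWithin (m := ∞) (by simp) hU.uniqueMDiffOn).comp hK
    hKU).congr fun t ht => ?_
  simp only [Function.comp, tangentMap, tangentMapWithin]
  rw [mfderivWithin_of_isOpen hU (hKU t ht)]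

theorem contMDiffOn_velocity {d : ℝ → M} {s : Set ℝ} (hs : IsOpen s)
    (hd : ContMDiffOn 𝓘(ℝ, ℝ) 𝓘(ℝ, E) ∞ d s) :
    ContMDiffOn 𝓘(ℝ, ℝ) 𝓘(ℝ, E).tangent ∞
      (fun t => tangentMap 𝓘(ℝ, ℝ) 𝓘(ℝ, E) d ⟨t, (1 : ℝ)⟩) s := by
  refine contMDiffOn_tangentMap_comp hs hd (K := fun t => ⟨t, (1 : ℝ)⟩) (fun t _ => ?_)
    fun t ht => ht
  exact contMDiffWithinAt_vectorSpace_iff_contDiffWithinAt.2 contDiffWithinAt_const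

end TangentBundle

/-! ### Lifts over a trivializing open set -/

section LocalLift

variable {EM EN EP EG M N P G : Type*}
  [NormedAddCommGroup EM] [NormedSpace ℝ EM] [NormedAddCommGroup EN] [NormedSpace ℝ EN]
  [NormedAddCommGroup EP] [NormedSpace ℝ EP] [NormedAddCommGroup EG] [NormedSpace ℝ EG]
  [TopologicalSpace M] [ChartedSpace EM M]
  [TopologicalSpace N] [ChartedSpace EN N]
  [TopologicalSpace P] [ChartedSpace EP P]
  [TopologicalSpace G] [ChartedSpace EG G] [Group G]
  [MulAction Gᵐᵒᵖ P] {π : P → M} {ν : N → M} {ρ : N → TangentBundle 𝓘(ℝ, EM) M}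
  {h : P × N → TangentBundle 𝓘(ℝ, EP) P} {a b ε : ℝ} {c : ℝ → N}

/-- Keeps the extension over `U`, so that the unit section can be taken along all of it. The anchor
condition is asserted on `[a, b]` only, where it is needed. -/
theorem IsSmoothAdmissible.exists_extension
    (hc : IsSmoothAdmissible 𝓘(ℝ, EM) 𝓘(ℝ, EN) ν univ ρ a b c)
    (hν : ContMDiff 𝓘(ℝ, EN) 𝓘(ℝ, EM) ∞ ν) {U : Set M} (hU : IsOpen U)
    (hcU : ∀ t ∈ Icc a b, ν (c t) ∈ U) :
    ∃ ε > 0, ∃ c' : ℝ → N, ContMDiffOn 𝓘(ℝ, ℝ) 𝓘(ℝ, EN) ∞ c' (Ioo (a - ε) (b + ε)) ∧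
      EqOn c c' (Icc a b) ∧ (∀ t ∈ Ioo (a - ε) (b + ε), ν (c' t) ∈ U) ∧
      ∀ t ∈ Icc a b, HasVelocity 𝓘(ℝ, EM) (fun s => ν (c' s)) t (ρ (c' t)) := by
  obtain ⟨ε, hε, c', hc', heq⟩ := hc.smooth
  have hopen : IsOpen (Ioo (a - ε) (b + ε) ∩ (fun t => ν (c' t)) ⁻¹' U) :=
    (hν.continuous.comp_continuousOn hc'.continuousOn).isOpen_inter_preimage isOpen_Ioo hU
  obtain ⟨ε', hε', hsub⟩ := exists_Ioo_subset_of_Icc_subset hc.lt.le hopen fun t ht =>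
    ⟨mem_of_mem_nhds (Ioo_mem_nhds_of_mem_Icc hε ht),
      show ν (c' t) ∈ U from heq ht ▸ hcU t ht⟩
  refine ⟨ε', hε', c', hc'.mono fun t ht => (hsub ht).1, heq, fun t ht => (hsub ht).2,
    fun t ht => ?_⟩
  exact hc.hasVelocity_extension hν ht (hc'.contMDiffAt (Ioo_mem_nhds_of_mem_Icc hε ht)) heq

theorem IsPrincipalBundle.tangentMap_velocity
    (hπ : IsPrincipalBundle 𝓘(ℝ, EM) 𝓘(ℝ, EP) 𝓘(ℝ, EG) G π) {d : ℝ → P} {γ : ℝ → M} {t : ℝ}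
    {X : TangentBundle 𝓘(ℝ, EM) M} (hd : MDifferentiableAt 𝓘(ℝ, ℝ) 𝓘(ℝ, EP) d t)
    (hγ : HasVelocity 𝓘(ℝ, EM) γ t X) (hev : ∀ᶠ s in nhds t, π (d s) = γ s) :
    tangentMap 𝓘(ℝ, EP) 𝓘(ℝ, EM) π (tangentMap 𝓘(ℝ, ℝ) 𝓘(ℝ, EP) d ⟨t, (1 : ℝ)⟩) = X :=
  (hd.hasVelocity.comp (hπ.mdifferentiableAt_proj _)).unique (hγ.congr_of_eventuallyEq hev)

/-- The unit section of a local trivialization along a curve in the base. -/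
theorem IsPrincipalTrivialization.exists_unit_lift {e : Bundle.Trivialization G π}
    (he : IsPrincipalTrivialization (EM := EM) (EP := EP) (EG := EG) e) {γ : ℝ → M} {s : Set ℝ}
    (hγ : ContMDiffOn 𝓘(ℝ, ℝ) 𝓘(ℝ, EM) ∞ γ s) (hγe : ∀ t ∈ s, γ t ∈ e.baseSet) :
    ∃ q : ℝ → P, ContMDiffOn 𝓘(ℝ, ℝ) 𝓘(ℝ, EP) ∞ q s ∧ (∀ t ∈ s, π (q t) = γ t) ∧
      ∀ t ∈ s, (e (q t)).2 = 1 :=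
  ⟨fun t => e.toOpenPartialHomeomorph.symm (γ t, 1),
    fun t ht => (he.contMDiffAt_symm 1 (hγe t ht)).comp_contMDiffWithinAt t (hγ t ht),
    fun t ht => e.proj_symm_apply' (hγe t ht),
    fun t ht => by rw [e.apply_symm_apply' (hγe t ht)]⟩

variable [LieGroup 𝓘(ℝ, EG) ∞ G]

/-- Two tangent vectors with the same projection differ by a vertical vector, which is determined
by its image under a linear left inverse of the infinitesimal action. -/
theorem IsPrincipalBundle.vec_eq_add (hπ : IsPrincipalBundle 𝓘(ℝ, EM) 𝓘(ℝ, EP) 𝓘(ℝ, EG) G π)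
    {u : P} {A : EP → EG} (hA : IsLinearMap ℝ A)
    (hAu : ∀ B : EG, A (vec (tangentMap 𝓘(ℝ, EG) 𝓘(ℝ, EP) (fun g : G => u <• g) ⟨1, B⟩)) = B)
    {X Z : TangentBundle 𝓘(ℝ, EP) P} (hX : X.proj = u) (hZ : Z.proj = u)
    (hXZ : tangentMap 𝓘(ℝ, EP) 𝓘(ℝ, EM) π X = tangentMap 𝓘(ℝ, EP) 𝓘(ℝ, EM) π Z) :
    vec Z = vec X + vec (tangentMap 𝓘(ℝ, EG) 𝓘(ℝ, EP) (fun g : G => u <• g)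
      ⟨1, A (vec Z) - A (vec X)⟩) := by
  obtain ⟨x, v⟩ := X
  obtain ⟨z, w⟩ := Z
  obtain rfl : x = u := hX
  obtain rfl : z = x := hZ
  have hvert : vec (tangentMap 𝓘(ℝ, EP) 𝓘(ℝ, EM) π
      (⟨z, w - v⟩ : TangentBundle 𝓘(ℝ, EP) P)) = 0 := by
    refine (ContinuousLinearMap.map_sub (mfderiv 𝓘(ℝ, EP) 𝓘(ℝ, EM) π z) w v).trans ?_
    have := congrArg vec hXZ
    exact sub_eq_zero.2 this.symm
  obtain ⟨B, hB⟩ := hπ.exists_eq_tangentMap_orbit hvert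
  have hB' : vec (⟨z, w⟩ : TangentBundle 𝓘(ℝ, EP) P) - vec (⟨z, v⟩ : TangentBundle 𝓘(ℝ, EP) P) =
    vec (tangentMap 𝓘(ℝ, EG) 𝓘(ℝ, EP) (fun g : G => z <• g) ⟨1, B⟩) := congrArg vec hB
  rw [← hA.map_sub, hB', hAu, ← hB', add_sub_cancel]

theorem exists_isSmoothRightSolution_shrink [CompleteSpace EG] [T2Space G] {Y : ℝ → EG}
    (hY : ContDiffOn ℝ ∞ Y (Ioo (a - ε) (b + ε))) (hε : 0 < ε) (hab : a ≤ b) (k : G) :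
    ∃ δ > 0, δ ≤ ε ∧ ∃ g : ℝ → G, IsSmoothRightSolution Y (Ioo (a - δ) (b + δ)) g ∧ g a = k := by
  obtain ⟨δ, hδ, g, hg, hga⟩ := exists_isSmoothRightSolution hY (by linarith) hab (by linarith) k
  refine ⟨min δ ε, lt_min hδ hε, min_le_right _ _, g, fun t ht => hg t ⟨?_, ?_⟩, hga⟩
  · linarith [ht.1, min_le_left δ ε]
  · linarith [ht.2, min_le_left δ ε]

variable [IsManifold 𝓘(ℝ, EP) ∞ P]

/-- The reduction to the group: the velocity of `d <• g` is `TR_g` of the right-hand side of `hY`,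
and equivariance of `h` turns this into the value of `h` at the translated point. -/
theorem IsPrincipalLift.isSmoothAdmissible_act
    (hπ : IsPrincipalBundle 𝓘(ℝ, EM) 𝓘(ℝ, EP) 𝓘(ℝ, EG) G π)
    (hh : IsPrincipalLift 𝓘(ℝ, EM) 𝓘(ℝ, EN) 𝓘(ℝ, EP) G π ν ρ h) (hab : a < b) (hε : 0 < ε)
    {c' : ℝ → N} (hc' : ContMDiffOn 𝓘(ℝ, ℝ) 𝓘(ℝ, EN) ∞ c' (Ioo (a - ε) (b + ε)))
    (heq : EqOn c c' (Icc a b)) {d : ℝ → P}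
    (hd : ContMDiffOn 𝓘(ℝ, ℝ) 𝓘(ℝ, EP) ∞ d (Ioo (a - ε) (b + ε)))
    (hdc : ∀ t ∈ Ioo (a - ε) (b + ε), π (d t) = ν (c' t)) {Y : ℝ → EG}
    (hY : ∀ t ∈ Icc a b, vec (h (d t, c' t)) =
      vec (tangentMap 𝓘(ℝ, ℝ) 𝓘(ℝ, EP) d ⟨t, (1 : ℝ)⟩) +
      vec (tangentMap 𝓘(ℝ, EG) 𝓘(ℝ, EP) (fun g : G => d t <• g) ⟨1, Y t⟩)) {g : ℝ → G}
    (hg : IsSmoothRightSolution Y (Ioo (a - ε) (b + ε)) g) :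
    IsSmoothAdmissible 𝓘(ℝ, EP) (𝓘(ℝ, EP).prod 𝓘(ℝ, EN)) Prod.fst (fibreProduct π ν) h a b
      fun t => (d t <• g t, c t) := by
  have hmem : ∀ t ∈ Icc a b, t ∈ Ioo (a - ε) (b + ε) := fun t ht =>
    mem_of_mem_nhds (Ioo_mem_nhds_of_mem_Icc hε ht)
  have hgs : ContMDiffOn 𝓘(ℝ, ℝ) 𝓘(ℝ, EG) ∞ g (Ioo (a - ε) (b + ε)) := fun t ht =>
    (hg t ht).1.contMDiffWithinAt
  refine .of_hasVelocity (c' := fun t => (d t <• g t, c' t)) hab hε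
    ((hπ.contMDiff_act.comp_contMDiffOn (hd.prodMk hgs)).prodMk hc')
    (fun t ht => by simp only [heq ht]) (fun t ht => ?_) fun t ht => ?_
  · exact (hπ.proj_act _ _).trans (hdc t (hmem t ht))
  · have hp : (d t, c' t) ∈ fibreProduct π ν := hdc t (hmem t ht)
    have hdt := (hd.contMDiffAt (Ioo_mem_nhds_of_mem_Icc hε ht)).mdifferentiableAt (by simp)
    have := hπ.hasVelocity_act hdt.hasVelocity (hg t (hmem t ht)).2 (hh.proj _ hp) (hY t ht)
    rw [hh.equivariant _ hp] at this
    exact this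

variable [CompleteSpace EG] [T2Space G]

/-- Local existence of lifts of admissible curves. -/
theorem IsPrincipalLift.exists_isSmoothAdmissible
    (hπ : IsPrincipalBundle 𝓘(ℝ, EM) 𝓘(ℝ, EP) 𝓘(ℝ, EG) G π) (hν : ContMDiff 𝓘(ℝ, EN) 𝓘(ℝ, EM) ∞ ν)
    (hh : IsPrincipalLift 𝓘(ℝ, EM) 𝓘(ℝ, EN) 𝓘(ℝ, EP) G π ν ρ h) {e : Bundle.Trivialization G π}
    (he : IsPrincipalTrivialization (EM := EM) (EP := EP) (EG := EG) e)
    (hc : IsSmoothAdmissible 𝓘(ℝ, EM) 𝓘(ℝ, EN) ν univ ρ a b c)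
    (hce : ∀ t ∈ Icc a b, ν (c t) ∈ e.baseSet) {u : P} (hu : π u = ν (c a)) :
    ∃ p : ℝ → P, IsSmoothAdmissible 𝓘(ℝ, EP) (𝓘(ℝ, EP).prod 𝓘(ℝ, EN)) Prod.fst
      (fibreProduct π ν) h a b (fun t => (p t, c t)) ∧ p a = u := by
  obtain ⟨ε, hε, c', hc', heq, hc'e, hvel⟩ := hc.exists_extension hν e.open_baseSet hce
  obtain ⟨q, hq, hqπ, hq1⟩ := he.exists_unit_lift (hν.comp_contMDiffOn hc') hc'e
  have hmem : ∀ t ∈ Icc a b, t ∈ Ioo (a - ε) (b + ε) := fun t ht =>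
    mem_of_mem_nhds (Ioo_mem_nhds_of_mem_Icc hε ht)
  have haI : a ∈ Icc a b := ⟨le_rfl, hc.lt.le⟩
  set φ : P → G := fun u => (e u).2
  have hU : IsOpen (π ⁻¹' e.baseSet) := hπ.contMDiff.continuous.isOpen_preimage _ e.open_baseSet
  have hqU : ∀ t ∈ Ioo (a - ε) (b + ε), π (q t) ∈ e.baseSet := fun t ht => by
    rw [hqπ t ht]; exact hc'e t ht
  set H : ℝ → TangentBundle 𝓘(ℝ, EP) P := fun t => h (q t, c' t)
  have hH : ContMDiffOn 𝓘(ℝ, ℝ) 𝓘(ℝ, EP).tangent ∞ H (Ioo (a - ε) (b + ε)) :=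
    hh.contMDiffOn.comp (hq.prodMk hc') fun t ht => hqπ t ht
  have hHq : ∀ t ∈ Ioo (a - ε) (b + ε), (H t).proj = q t := fun t ht => hh.proj _ (hqπ t ht)
  -- The left inverse of the infinitesimal action is the derivative of the fibre coordinate `φ`.
  -- Since `φ ∘ q = 1`, all these vectors lie in `T_1 G`, so `Y` is smooth, and the velocity of `q`
  -- contributes nothing.
  set Y : ℝ → EG := fun t => vec (tangentMap 𝓘(ℝ, EP) 𝓘(ℝ, EG) φ (H t))
  have hY : ContDiffOn ℝ ∞ Y (Ioo (a - ε) (b + ε)) := by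
    refine contDiffOn_vec_of_proj_eq (x := (1 : G)) (contMDiffOn_tangentMap_comp hU
      (fun u hu => (he.contMDiffAt_snd hu).contMDiffWithinAt) hH fun t ht => ?_) fun t ht => ?_
    · rw [hHq t ht]; exact hqU t ht
    · exact (congrArg φ (hHq t ht)).trans (hq1 t ht)
  have key : ∀ t ∈ Icc a b, vec (h (q t, c' t)) =
      vec (tangentMap 𝓘(ℝ, ℝ) 𝓘(ℝ, EP) q ⟨t, (1 : ℝ)⟩) +
      vec (tangentMap 𝓘(ℝ, EG) 𝓘(ℝ, EP) (fun g : G => q t <• g) ⟨1, Y t⟩) := by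
    intro t ht
    have ht' := hmem t ht
    let A : EP →L[ℝ] EG := mfderiv 𝓘(ℝ, EP) 𝓘(ℝ, EG) φ (q t)
    have hqd : MDifferentiableAt 𝓘(ℝ, ℝ) 𝓘(ℝ, EP) q t :=
      (hq.contMDiffAt (Ioo_mem_nhds_of_mem_Icc hε ht)).mdifferentiableAt (by simp)
    have hev : ∀ᶠ s in nhds t, s ∈ Ioo (a - ε) (b + ε) := Ioo_mem_nhds_of_mem_Icc hε ht
    have hA : ∀ X : TangentBundle 𝓘(ℝ, EP) P, X.proj = q t →
        vec (tangentMap 𝓘(ℝ, EP) 𝓘(ℝ, EG) φ X) = A (vec X) := by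
      rintro ⟨x, v⟩ rfl
      rfl
    have hq0 : A (vec (tangentMap 𝓘(ℝ, ℝ) 𝓘(ℝ, EP) q ⟨t, (1 : ℝ)⟩)) = 0 := by
      rw [← hA _ rfl]
      have h1 := hqd.hasVelocity.comp (he.mdifferentiableAt_snd (hqU t ht'))
      have h2 : HasVelocity 𝓘(ℝ, EG) (fun s => φ (q s)) t ⟨1, 0⟩ :=
        (hasVelocity_const 1 t).congr_of_eventuallyEq (hev.mono fun s hs => hq1 s hs)
      rw [h1.unique h2]
      rfl
    have := hπ.vec_eq_add (u := q t) (A := A) A.toLinearMap.isLinear (fun B => ?_) (X := _)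
      (Z := H t) rfl (hHq t ht') ((hπ.tangentMap_velocity hqd (hvel t ht)
        (hev.mono fun s hs => hqπ s hs)).trans (hh.tangentMap_proj (q t, c' t) (hqπ t ht')).symm)
    · rw [hq0, sub_zero, ← hA _ (hHq t ht')] at this
      exact this
    · rw [← hA _ (act_one _), he.tangentMap_snd_orbit hπ (hqU t ht') (hq1 t ht')]
      rfl
  obtain ⟨δ, hδ, hδε, g, hg, hga⟩ :=
    exists_isSmoothRightSolution_shrink (G := G) hY hε hc.lt.le (φ u)
  have hsub : Ioo (a - δ) (b + δ) ⊆ Ioo (a - ε) (b + ε) :=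
    Ioo_subset_Ioo (by linarith) (by linarith)
  refine ⟨fun t => q t <• g t, hh.isSmoothAdmissible_act hπ hc.lt hδ (hc'.mono hsub) heq
    (hq.mono hsub) (fun t ht => hqπ t (hsub ht)) key hg, ?_⟩
  have hqa := hqπ a (hmem a haI)
  refine IsPrincipalTrivialization.injOn_snd (e := e) ?_ ?_ ?_
  · rw [hπ.proj_act]; exact hqU a (hmem a haI)
  · rw [hπ.proj_act, hqa, hu, heq haI]; rfl
  · rw [he.snd_act (hqU a (hmem a haI)), hq1 a (hmem a haI), one_mul, hga]

omit [CompleteSpace EG] [T2Space G] [LieGroup 𝓘(ℝ, EG) ∞ G] in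
/-- The kernel of a connection form is invariant under the right action. -/
theorem IsConnectionForm.tangentMap_act_eq_zero {θ : TangentBundle 𝓘(ℝ, EP) P → EG}
    (hθ : IsConnectionForm (G := G) 𝓘(ℝ, EP) 𝓘(ℝ, EG) θ) (g : G) {X : TangentBundle 𝓘(ℝ, EP) P}
    (hX : θ X = 0) : θ (tangentMap 𝓘(ℝ, EP) 𝓘(ℝ, EP) (fun u : P => u <• g) X) = 0 := by
  have h1 := congrArg vec (hθ.equivariant g X)
  rw [hX] at h1
  exact h1.trans
    (mfderiv 𝓘(ℝ, EG) 𝓘(ℝ, EG) (fun x : G => g⁻¹ * x * g) (1 : G)).map_zero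

omit [CompleteSpace EG] [T2Space G] [LieGroup 𝓘(ℝ, EG) ∞ G] in
theorem IsConnectionForm.isLinearMap {θ : TangentBundle 𝓘(ℝ, EP) P → EG}
    (hθ : IsConnectionForm (G := G) 𝓘(ℝ, EP) 𝓘(ℝ, EG) θ) (u : P) :
    IsLinearMap ℝ fun v : EP => θ ⟨u, v⟩ :=
  hθ.linear u

omit [CompleteSpace EG] [T2Space G] [LieGroup 𝓘(ℝ, EG) ∞ G] in
theorem IsConnectionForm.apply_orbit {θ : TangentBundle 𝓘(ℝ, EP) P → EG}
    (hθ : IsConnectionForm (G := G) 𝓘(ℝ, EP) 𝓘(ℝ, EG) θ) (u : P) (B : EG) :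
    θ ⟨u, vec (E := EP) (tangentMap 𝓘(ℝ, EG) 𝓘(ℝ, EP) (fun g : G => u <• g) ⟨1, B⟩)⟩ = B := by
  refine Eq.trans (congrArg θ ?_) (hθ.fundamental u B)
  exact ext_vec (act_one u).symm rfl

/-- Local existence of horizontal lifts, and the construction of lifts of admissible curves from
them. -/
theorem IsPrincipalLift.exists_horizontal
    (hπ : IsPrincipalBundle 𝓘(ℝ, EM) 𝓘(ℝ, EP) 𝓘(ℝ, EG) G π) (hν : ContMDiff 𝓘(ℝ, EN) 𝓘(ℝ, EM) ∞ ν)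
    (hh : IsPrincipalLift 𝓘(ℝ, EM) 𝓘(ℝ, EN) 𝓘(ℝ, EP) G π ν ρ h) {e : Bundle.Trivialization G π}
    (he : IsPrincipalTrivialization (EM := EM) (EP := EP) (EG := EG) e)
    (hc : IsSmoothAdmissible 𝓘(ℝ, EM) 𝓘(ℝ, EN) ν univ ρ a b c)
    (hce : ∀ t ∈ Icc a b, ν (c t) ∈ e.baseSet) {θ : TangentBundle 𝓘(ℝ, EP) P → EG}
    (hθ : IsConnectionForm (G := G) 𝓘(ℝ, EP) 𝓘(ℝ, EG) θ) {u : P} (hu : π u = ν (c a)) (k : G) :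
    ∃ (X : ℝ → TangentBundle 𝓘(ℝ, EP) P) (d : ℝ → P) (g : ℝ → G),
      IsSmoothAdmissible 𝓘(ℝ, EP) 𝓘(ℝ, EP).tangent
        (fun v : TangentBundle 𝓘(ℝ, EP) P => v.proj) {v | θ v = 0} id a b X ∧
      (∀ t ∈ Icc a b, (X t).proj = d t) ∧ (∀ t ∈ Icc a b, π (d t) = ν (c t)) ∧ d a = u ∧
      IsSmoothAdmissible 𝓘(ℝ, EG) (𝓘(ℝ, EG).prod 𝓘(ℝ, EG)) (fun p : G × EG => p.1) univ
        (fun p => tangentMap 𝓘(ℝ, EG) 𝓘(ℝ, EG) (fun x : G => x * p.1) ⟨1, p.2⟩) a b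
        (fun t => (g t, θ (h (d t, c t)))) ∧ g a = k ∧
      IsSmoothAdmissible 𝓘(ℝ, EP) (𝓘(ℝ, EP).prod 𝓘(ℝ, EN)) Prod.fst (fibreProduct π ν) h a b
        fun t => (d t <• g t, c t) := by
  obtain ⟨ε, hε, c', hc', heq, hc'e, hvel⟩ := hc.exists_extension hν e.open_baseSet hce
  obtain ⟨q, hq, hqπ, hq1⟩ := he.exists_unit_lift (hν.comp_contMDiffOn hc') hc'e
  have haI : a ∈ Icc a b := ⟨le_rfl, hc.lt.le⟩
  have haε : a ∈ Ioo (a - ε) (b + ε) := mem_of_mem_nhds (Ioo_mem_nhds_of_mem_Icc hε haI)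
  have hqU : ∀ t ∈ Ioo (a - ε) (b + ε), π (q t) ∈ e.baseSet := fun t ht => by
    rw [hqπ t ht]; exact hc'e t ht
  -- the horizontal lift
  set Y₁ : ℝ → EG := fun t => -θ (tangentMap 𝓘(ℝ, ℝ) 𝓘(ℝ, EP) q ⟨t, (1 : ℝ)⟩)
  have hY₁ : ContDiffOn ℝ ∞ Y₁ (Ioo (a - ε) (b + ε)) :=
    (contMDiffOn_iff_contDiffOn.1
      (hθ.contMDiff.comp_contMDiffOn (contMDiffOn_velocity isOpen_Ioo hq))).neg
  obtain ⟨δ, hδ, hδε, f, hf, hfa⟩ :=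
    exists_isSmoothRightSolution_shrink (G := G) hY₁ hε hc.lt.le (e u).2
  have hsub : Ioo (a - δ) (b + δ) ⊆ Ioo (a - ε) (b + ε) :=
    Ioo_subset_Ioo (by linarith) (by linarith)
  have hfs : ContMDiffOn 𝓘(ℝ, ℝ) 𝓘(ℝ, EG) ∞ f (Ioo (a - δ) (b + δ)) := fun t ht =>
    (hf t ht).1.contMDiffWithinAt
  set d : ℝ → P := fun t => q t <• f t
  have hd : ContMDiffOn 𝓘(ℝ, ℝ) 𝓘(ℝ, EP) ∞ d (Ioo (a - δ) (b + δ)) :=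
    hπ.contMDiff_act.comp_contMDiffOn ((hq.mono hsub).prodMk hfs)
  have hdπ : ∀ t ∈ Ioo (a - δ) (b + δ), π (d t) = ν (c' t) := fun t ht =>
    (hπ.proj_act _ _).trans (hqπ t (hsub ht))
  have hmem : ∀ t ∈ Icc a b, t ∈ Ioo (a - δ) (b + δ) := fun t ht =>
    mem_of_mem_nhds (Ioo_mem_nhds_of_mem_Icc hδ ht)
  have hdd : ∀ t ∈ Icc a b, MDifferentiableAt 𝓘(ℝ, ℝ) 𝓘(ℝ, EP) d t := fun t ht =>
    (hd.contMDiffAt (Ioo_mem_nhds_of_mem_Icc hδ ht)).mdifferentiableAt (by simp)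
  have hda : d a = u := by
    refine IsPrincipalTrivialization.injOn_snd (e := e) ?_ ?_ ?_
    · rw [hπ.proj_act]; exact hqU a haε
    · rw [hdπ a (hmem a haI), hu, heq haI]
    · rw [he.snd_act (hqU a haε), hq1 a haε, one_mul, hfa]
  set X : ℝ → TangentBundle 𝓘(ℝ, EP) P := fun t => tangentMap 𝓘(ℝ, ℝ) 𝓘(ℝ, EP) d ⟨t, (1 : ℝ)⟩
  have hXs : ContMDiffOn 𝓘(ℝ, ℝ) 𝓘(ℝ, EP).tangent ∞ X (Ioo (a - δ) (b + δ)) :=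
    contMDiffOn_velocity isOpen_Ioo hd
  have hXθ : ∀ t ∈ Icc a b, θ (X t) = 0 := by
    intro t ht
    have hqd : MDifferentiableAt 𝓘(ℝ, ℝ) 𝓘(ℝ, EP) q t :=
      (hq.contMDiffAt (Ioo_mem_nhds_of_mem_Icc hε ht)).mdifferentiableAt (by simp)
    set v : EP := vec (tangentMap 𝓘(ℝ, ℝ) 𝓘(ℝ, EP) q ⟨t, (1 : ℝ)⟩) with hv
    set w : EP := vec (tangentMap 𝓘(ℝ, EG) 𝓘(ℝ, EP) (fun g : G => q t <• g) ⟨1, Y₁ t⟩) with hw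
    -- The velocity of `d` is the translate of `v + w`, and `θ` sends `v` and `w` to opposite values
    -- by the choice of `Y₁`.
    have h1 := (hπ.hasVelocity_act (Z := ⟨q t, v + w⟩) hqd.hasVelocity (hf t (hmem t ht)).2 rfl
      rfl).eq
    refine (congrArg θ h1).trans (hθ.tangentMap_act_eq_zero _ ?_)
    refine ((hθ.isLinearMap (q t)).map_add v w).trans ?_
    rw [hw, hθ.apply_orbit]
    exact add_neg_cancel _
  -- the curve in the group
  set Y₂ : ℝ → EG := fun t => θ (h (d t, c' t))
  have hY₂ : ContDiffOn ℝ ∞ Y₂ (Ioo (a - δ) (b + δ)) :=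
    contMDiffOn_iff_contDiffOn.1 (hθ.contMDiff.comp_contMDiffOn
      (hh.contMDiffOn.comp (hd.prodMk (hc'.mono hsub)) fun t ht => hdπ t ht))
  have key : ∀ t ∈ Icc a b, vec (h (d t, c' t)) = vec (X t) +
      vec (tangentMap 𝓘(ℝ, EG) 𝓘(ℝ, EP) (fun g : G => d t <• g) ⟨1, Y₂ t⟩) := by
    intro t ht
    have hp := hdπ t (hmem t ht)
    have hev : ∀ᶠ s in nhds t, π (d s) = ν (c' s) := by
      filter_upwards [Ioo_mem_nhds_of_mem_Icc hδ ht] with s hs using hdπ s hs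
    have h1 := hπ.vec_eq_add (u := d t) (hθ.isLinearMap (d t)) (hθ.apply_orbit (d t)) (X := X t)
      (Z := h (d t, c' t)) rfl (hh.proj (d t, c' t) hp)
      ((hπ.tangentMap_velocity (hdd t ht) (hvel t ht) hev).trans
        (hh.tangentMap_proj (d t, c' t) hp).symm)
    -- With `θ` as left inverse, horizontality of `d` removes one term of the difference and leaves
    -- `Y₂`.
    have h2 : θ ⟨d t, vec (E := EP) (X t)⟩ = 0 := hXθ t ht
    have h3 : θ ⟨d t, vec (E := EP) (h (d t, c' t))⟩ = Y₂ t :=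
      congrArg θ (ext_vec (hh.proj (d t, c' t) hp).symm rfl)
    simp only [h2, h3, sub_zero] at h1
    exact h1
  obtain ⟨η, hη, hηδ, g, hg, hga⟩ :=
    exists_isSmoothRightSolution_shrink (G := G) hY₂ hδ hc.lt.le k
  have hsub' : Ioo (a - η) (b + η) ⊆ Ioo (a - δ) (b + δ) :=
    Ioo_subset_Ioo (by linarith) (by linarith)
  have hgs : ContMDiffOn 𝓘(ℝ, ℝ) 𝓘(ℝ, EG) ∞ g (Ioo (a - η) (b + η)) := fun t ht =>
    (hg t ht).1.contMDiffWithinAt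
  refine ⟨X, d, g, ?_, fun _ _ => rfl, fun t ht => ?_, hda, ?_, hga, ?_⟩
  · exact .of_hasVelocity hc.lt hδ hXs (fun _ _ => rfl) hXθ fun t ht => (hdd t ht).hasVelocity
  · rw [hdπ t (hmem t ht), heq ht]
  · refine .of_hasVelocity (c' := fun t => (g t, Y₂ t)) hc.lt hη
      (hgs.prodMk (contMDiffOn_iff_contDiffOn.2 (hY₂.mono hsub')))
      (fun t ht => by simp only [heq ht, Y₂]) (fun _ _ => mem_univ _) fun t ht => ?_
    exact (hg t (mem_of_mem_nhds (Ioo_mem_nhds_of_mem_Icc hη ht))).2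
  · exact hh.isSmoothAdmissible_act hπ hc.lt hη (hc'.mono (hsub'.trans hsub)) heq
      (hd.mono hsub') (fun t ht => hdπ t (hsub' ht)) key hg

end LocalLift

/-! ### Existence and uniqueness along arbitrary admissible curves -/

section GlobalLift

variable {EM EN EP EG M N P G : Type*}
  [NormedAddCommGroup EM] [NormedSpace ℝ EM] [NormedAddCommGroup EN] [NormedSpace ℝ EN]
  [NormedAddCommGroup EP] [NormedSpace ℝ EP] [NormedAddCommGroup EG] [NormedSpace ℝ EG]
  [CompleteSpace EG]
  [TopologicalSpace M] [ChartedSpace EM M] [TopologicalSpace N] [ChartedSpace EN N]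
  [TopologicalSpace P] [ChartedSpace EP P] [IsManifold 𝓘(ℝ, EP) ∞ P]
  [TopologicalSpace G] [T2Space G] [ChartedSpace EG G] [Group G] [LieGroup 𝓘(ℝ, EG) ∞ G]
  [MulAction Gᵐᵒᵖ P] {π : P → M} {ν : N → M} {ρ : N → TangentBundle 𝓘(ℝ, EM) M}
  {h : P × N → TangentBundle 𝓘(ℝ, EP) P} {a b : ℝ} {c : ℝ → N}

/-- Existence of lifts of admissible curves. -/
theorem IsPrincipalLift.exists_isAdmissible
    (hπ : IsPrincipalBundle 𝓘(ℝ, EM) 𝓘(ℝ, EP) 𝓘(ℝ, EG) G π) (hν : ContMDiff 𝓘(ℝ, EN) 𝓘(ℝ, EM) ∞ ν)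
    (hh : IsPrincipalLift 𝓘(ℝ, EM) 𝓘(ℝ, EN) 𝓘(ℝ, EP) G π ν ρ h)
    (hc : IsAdmissible 𝓘(ℝ, EM) 𝓘(ℝ, EN) ν univ ρ a b c) : ∀ u : P, π u = ν (c a) →
    ∃ p : ℝ → P, IsAdmissible 𝓘(ℝ, EP) (𝓘(ℝ, EP).prod 𝓘(ℝ, EN)) Prod.fst
      (fibreProduct π ν) h a b (fun t => (p t, c t)) ∧ p a = u := by
  choose e hxe he using hπ.exists_principalTrivialization
  refine hc.induction_of_cover hν (U := fun x => (e x).baseSet) (fun x => (e x).open_baseSet)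
    (fun x => ⟨x, hxe x⟩) (Q := fun a b c => ∀ u : P, π u = ν (c a) → ∃ p : ℝ → P,
      IsAdmissible 𝓘(ℝ, EP) (𝓘(ℝ, EP).prod 𝓘(ℝ, EN)) Prod.fst
      (fibreProduct π ν) h a b (fun t => (p t, c t)) ∧ p a = u) ?_ ?_
  · intro a b c x hc hcx u hu
    obtain ⟨p, hp, hpa⟩ := hh.exists_isSmoothAdmissible hπ hν (he x) hc hcx hu
    exact ⟨p, .smooth hp, hpa⟩
  · intro a m b c₁ c₂ c ham hmb h₁ h₂ hm e₁ e₂ u hu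
    obtain ⟨p₁, hp₁, hpa⟩ := h₁ u (by rw [hu, e₁ ⟨le_rfl, ham.le⟩])
    have hpm : π (p₁ m) = ν (c₁ m) := hp₁.mem m ⟨ham.le, le_rfl⟩
    obtain ⟨p₂, hp₂, hpb⟩ := h₂ (p₁ m) (hpm.trans hm)
    refine ⟨fun t => if t ≤ m then p₁ t else p₂ t, hp₁.trans hp₂ hpb.symm (fun t ht => ?_)
      (fun t ht => ?_), by simp only [ham.le, if_true, hpa]⟩
    · simp only [ht.2, if_true, e₁ ht]
    · simp only [ht.1.not_ge, if_false, e₂ ht]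

/-- Existence of horizontal lifts, and the construction of lifts of admissible curves from them. -/
theorem IsPrincipalLift.exists_horizontal_isAdmissible
    (hπ : IsPrincipalBundle 𝓘(ℝ, EM) 𝓘(ℝ, EP) 𝓘(ℝ, EG) G π) (hν : ContMDiff 𝓘(ℝ, EN) 𝓘(ℝ, EM) ∞ ν)
    (hh : IsPrincipalLift 𝓘(ℝ, EM) 𝓘(ℝ, EN) 𝓘(ℝ, EP) G π ν ρ h)
    (hc : IsAdmissible 𝓘(ℝ, EM) 𝓘(ℝ, EN) ν univ ρ a b c) {θ : TangentBundle 𝓘(ℝ, EP) P → EG}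
    (hθ : IsConnectionForm (G := G) 𝓘(ℝ, EP) 𝓘(ℝ, EG) θ) : ∀ (u : P) (k : G), π u = ν (c a) →
    ∃ (d : ℝ → P) (g : ℝ → G), IsHorizontalLift 𝓘(ℝ, EP) θ π (fun t => ν (c t)) a b d ∧ d a = u ∧
      IsRightLogarithmicSolution 𝓘(ℝ, EG) (fun t => θ (h (d t, c t))) a b g ∧ g a = k ∧
      IsAdmissible 𝓘(ℝ, EP) (𝓘(ℝ, EP).prod 𝓘(ℝ, EN)) Prod.fst (fibreProduct π ν) h a b
        fun t => (d t <• g t, c t) := by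
  choose e hxe he using hπ.exists_principalTrivialization
  refine hc.induction_of_cover hν (U := fun x => (e x).baseSet) (fun x => (e x).open_baseSet)
    (fun x => ⟨x, hxe x⟩) (Q := fun a b c => ∀ (u : P) (k : G), π u = ν (c a) →
    ∃ (d : ℝ → P) (g : ℝ → G), IsHorizontalLift 𝓘(ℝ, EP) θ π (fun t => ν (c t)) a b d ∧ d a = u ∧
      IsRightLogarithmicSolution 𝓘(ℝ, EG) (fun t => θ (h (d t, c t))) a b g ∧ g a = k ∧
      IsAdmissible 𝓘(ℝ, EP) (𝓘(ℝ, EP).prod 𝓘(ℝ, EN)) Prod.fst (fibreProduct π ν) h a b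
        fun t => (d t <• g t, c t)) ?_ ?_
  · intro a b c x hc hcx u k hu
    obtain ⟨X, d, g, hX, hXd, hd, hda, hg, hga, hdg⟩ :=
      hh.exists_horizontal hπ hν (he x) hc hcx hθ hu k
    exact ⟨d, g, ⟨⟨X, .smooth hX, hXd⟩, hd⟩, hda, .smooth hg, hga, .smooth hdg⟩
  · intro a m b c₁ c₂ c ham hmb h₁ h₂ hm e₁ e₂ u k hu
    obtain ⟨d₁, g₁, ⟨⟨X₁, hX₁, hXd₁⟩, hd₁⟩, hda₁, hg₁, hga₁, hdg₁⟩ :=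
      h₁ u k (by rw [hu, e₁ ⟨le_rfl, ham.le⟩])
    have hmI : m ∈ Icc a m := ⟨ham.le, le_rfl⟩
    have hmI' : m ∈ Icc m b := ⟨le_rfl, hmb.le⟩
    obtain ⟨d₂, g₂, ⟨⟨X₂, hX₂, hXd₂⟩, hd₂⟩, hda₂, hg₂, hga₂, hdg₂⟩ :=
      -- The second piece starts where the first ends, in `P` and in `G`; this is why the induction
      -- allows every initial value `k`.
      h₂ (d₁ m) (g₁ m) ((hd₁ m hmI).trans hm)
    refine ⟨fun t => if t ≤ m then d₁ t else d₂ t, fun t => if t ≤ m then g₁ t else g₂ t,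
      ⟨⟨_, hX₁.ite hX₂ ?_, fun t ht => ?_⟩, fun t ht => ?_⟩, by simp only [ham.le, if_true, hda₁],
      hg₁.trans hg₂ hga₂.symm (fun t ht => ?_) (fun t ht => ?_),
      by simp only [ham.le, if_true, hga₁],
      hdg₁.trans hdg₂ (by rw [hda₂, hga₂]) (fun t ht => ?_) (fun t ht => ?_)⟩
    · rw [hXd₁ m hmI, hXd₂ m hmI', hda₂]
    · dsimp only
      split_ifs with htm
      · exact hXd₁ t ⟨ht.1, htm⟩
      · exact hXd₂ t ⟨(not_le.1 htm).le, ht.2⟩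
    · dsimp only
      split_ifs with htm
      · rw [hd₁ t ⟨ht.1, htm⟩, e₁ ⟨ht.1, htm⟩]
      · rw [hd₂ t ⟨(not_le.1 htm).le, ht.2⟩, e₂ ⟨not_le.1 htm, ht.2⟩]
    · simp only [ht.2, if_true, e₁ ht]
    · simp only [ht.1.not_ge, if_false, e₂ ht]
    · simp only [ht.2, if_true, e₁ ht]
    · simp only [ht.1.not_ge, if_false, e₂ ht]

/-- Uniqueness of lifts of admissible curves. -/
theorem IsPrincipalLift.eqOn [T2Space P] (hπ : IsPrincipalBundle 𝓘(ℝ, EM) 𝓘(ℝ, EP) 𝓘(ℝ, EG) G π)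
    (hh : IsPrincipalLift 𝓘(ℝ, EM) 𝓘(ℝ, EN) 𝓘(ℝ, EP) G π ν ρ h) {e e' : ℝ → P × N}
    (he : IsAdmissible 𝓘(ℝ, EP) (𝓘(ℝ, EP).prod 𝓘(ℝ, EN)) Prod.fst (fibreProduct π ν) h a b e)
    (he' : IsAdmissible 𝓘(ℝ, EP) (𝓘(ℝ, EP).prod 𝓘(ℝ, EN)) Prod.fst (fibreProduct π ν) h a b e')
    (h2 : ∀ t ∈ Icc a b, (e' t).2 = (e t).2) (ha : (e' a).1 = (e a).1) : EqOn e' e (Icc a b) := by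
  obtain ⟨s, hs, H⟩ := he.exists_finite_hasVelocity contMDiff_fst
  obtain ⟨s', hs', H'⟩ := he'.exists_finite_hasVelocity contMDiff_fst
  have hbase : ∀ t ∈ Icc a b, π (e' t).1 = π (e t).1 := fun t ht => by
    rw [show π (e' t).1 = ν (e' t).2 from he'.mem t ht, h2 t ht]
    exact (he.mem t ht).symm
  have := hπ.eqOn_of_hasVelocity (he.continuousOn continuous_fst)
    (he'.continuousOn continuous_fst) hbase (hs.union hs') (fun t ht => ?_) ha
  · exact fun t ht => Prod.ext (this ht) (h2 t ht)
  · have htI := Ioo_subset_Icc_self ht.1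
    refine ⟨_, H t ⟨ht.1, fun hts => ht.2 (Or.inl hts)⟩, fun k hk => ?_⟩
    -- Equivariance of `h` is exactly the correspondence of velocities required by
    -- `eqOn_of_hasVelocity`.
    rw [hh.equivariant _ (he.mem t htI), ← hk, ← h2 t htI]
    exact H' t ⟨ht.1, fun hts => ht.2 (Or.inr hts)⟩

omit [NormedSpace ℝ EG] [CompleteSpace EG] [TopologicalSpace M] in
theorem IsHorizontalLift.exists_finite_hasVelocity {θ : TangentBundle 𝓘(ℝ, EP) P → EG} {γ : ℝ → M}
    {d : ℝ → P} (hd : IsHorizontalLift 𝓘(ℝ, EP) θ π γ a b d) :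
    ContinuousOn d (Icc a b) ∧ ∃ s : Set ℝ, s.Finite ∧
      ∀ t ∈ Ioo a b \ s, ∃ X, θ X = 0 ∧ HasVelocity 𝓘(ℝ, EP) d t X := by
  obtain ⟨⟨X, hX, hXd⟩, hdγ⟩ := hd
  have hproj : ContMDiff 𝓘(ℝ, EP).tangent 𝓘(ℝ, EP) ∞
    (fun v : TangentBundle 𝓘(ℝ, EP) P => v.proj) := Bundle.contMDiff_proj _
  refine ⟨(hX.continuousOn hproj.continuous).congr fun t ht => (hXd t ht).symm, ?_⟩
  obtain ⟨s, hs, H⟩ := hX.exists_finite_hasVelocity hproj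
  refine ⟨s, hs, fun t ht => ⟨X t, hX.mem t (Ioo_subset_Icc_self ht.1),
    (H t ht).congr_of_eventuallyEq ?_⟩⟩
  filter_upwards [Icc_mem_nhds ht.1.1 ht.1.2] with r hr using (hXd r hr).symm

/-- Uniqueness of horizontal lifts. -/
theorem IsConnectionForm.eqOn [T2Space P] (hπ : IsPrincipalBundle 𝓘(ℝ, EM) 𝓘(ℝ, EP) 𝓘(ℝ, EG) G π)
    {θ : TangentBundle 𝓘(ℝ, EP) P → EG} (hθ : IsConnectionForm (G := G) 𝓘(ℝ, EP) 𝓘(ℝ, EG) θ)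
    {γ : ℝ → M} {d d' : ℝ → P} (hd : IsHorizontalLift 𝓘(ℝ, EP) θ π γ a b d)
    (hd' : IsHorizontalLift 𝓘(ℝ, EP) θ π γ a b d') (ha : d' a = d a) :
    EqOn d' d (Icc a b) := by
  obtain ⟨hc, s, hs, H⟩ := hd.exists_finite_hasVelocity
  obtain ⟨hc', s', hs', H'⟩ := hd'.exists_finite_hasVelocity
  refine hπ.eqOn_of_hasVelocity hc hc' (fun t ht => by rw [hd.2 t ht, hd'.2 t ht])
    (hs.union hs') (fun t ht => ?_) ha
  obtain ⟨X, hX0, hX⟩ := H t ⟨ht.1, fun hts => ht.2 (Or.inl hts)⟩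
  obtain ⟨X', hX0', hX'⟩ := H' t ⟨ht.1, fun hts => ht.2 (Or.inr hts)⟩
  refine ⟨X, hX, fun k hk => ?_⟩
  -- `W` and `X'` are horizontal vectors at `d' t` with the same projection, so their vertical
  -- difference, measured by `θ`, is zero.
  set W := tangentMap 𝓘(ℝ, EP) 𝓘(ℝ, EP) (fun u : P => u <• k) X with hW
  have hWp : W.proj = d' t := by rw [hk, ← hX.proj_eq, hW]; rfl
  have hW0 : θ W = 0 := hθ.tangentMap_act_eq_zero k hX0
  have hπW : tangentMap 𝓘(ℝ, EP) 𝓘(ℝ, EM) π W = tangentMap 𝓘(ℝ, EP) 𝓘(ℝ, EM) π X := by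
    rw [hW, ← tangentMap_comp_at _ (hπ.mdifferentiableAt_proj _)
      (hπ.mdifferentiableAt_act_right k _)]
    congr 1
    funext u
    exact hπ.proj_act u k
  have hπX : tangentMap 𝓘(ℝ, EP) 𝓘(ℝ, EM) π X = tangentMap 𝓘(ℝ, EP) 𝓘(ℝ, EM) π X' := by
    refine (hX.comp (hπ.mdifferentiableAt_proj _)).unique
      ((hX'.comp (hπ.mdifferentiableAt_proj _)).congr_of_eventuallyEq ?_)
    filter_upwards [Icc_mem_nhds ht.1.1 ht.1.2] with r hr
    rw [hd.2 r hr, hd'.2 r hr]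
  have hθv : ∀ Z : TangentBundle 𝓘(ℝ, EP) P, Z.proj = d' t → θ ⟨d' t, vec (E := EP) Z⟩ = θ Z :=
    fun Z hZ => congrArg θ (ext_vec hZ.symm rfl)
  have hv := hπ.vec_eq_add (hθ.isLinearMap (d' t)) (hθ.apply_orbit (d' t)) hX'.proj_eq hWp
    (hπX.symm.trans hπW.symm)
  simp only [hθv _ hX'.proj_eq, hθv _ hWp, hX0', hW0, sub_zero] at hv
  have h0 : vec (tangentMap 𝓘(ℝ, EG) 𝓘(ℝ, EP) (fun g : G => d' t <• g) ⟨1, (0 : EG)⟩) = 0 :=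
    (mfderiv 𝓘(ℝ, EG) 𝓘(ℝ, EP) (fun g : G => d' t <• g) (1 : G)).map_zero
  rw [h0, add_zero] at hv
  rw [ext_vec (hWp.trans hX'.proj_eq.symm) hv]
  exact hX'

/-- Uniqueness of solutions of `ġ g⁻¹ = Y`. -/
theorem IsRightLogarithmicSolution.eqOn {Y : ℝ → EG} {g g' : ℝ → G}
    (hg : IsRightLogarithmicSolution 𝓘(ℝ, EG) Y a b g)
    (hg' : IsRightLogarithmicSolution 𝓘(ℝ, EG) Y a b g') (ha : g' a = g a) :
    EqOn g' g (Icc a b) := by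
  obtain ⟨s, hs, H⟩ := IsAdmissible.exists_finite_hasVelocity hg contMDiff_fst
  obtain ⟨s', hs', H'⟩ := IsAdmissible.exists_finite_hasVelocity hg' contMDiff_fst
  intro t ht
  have := inv_mul_eq_of_hasVelocity (E := EG) (IsAdmissible.continuousOn hg continuous_fst)
    (IsAdmissible.continuousOn hg' continuous_fst) (hs.union hs') (fun t ht => ?_) ht
  · rw [ha, inv_mul_cancel] at this
    exact (inv_mul_eq_one.1 this).symm
  · refine ⟨_, H t ⟨ht.1, fun hts => ht.2 (Or.inl hts)⟩, ?_⟩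
    rw [tangentMap_mul_right_mul_right, mul_inv_cancel_left]
    exact H' t ⟨ht.1, fun hts => ht.2 (Or.inr hts)⟩

end GlobalLift

/-! ### The distribution generated by the lifted sections -/

section Distribution

variable {EM EF EN EP M F N P G : Type*}
  [NormedAddCommGroup EM] [NormedSpace ℝ EM] [NormedAddCommGroup EF] [NormedSpace ℝ EF]
  [NormedAddCommGroup EN] [NormedSpace ℝ EN] [NormedAddCommGroup EP] [NormedSpace ℝ EP]
  [TopologicalSpace M] [ChartedSpace EM M] [TopologicalSpace F] [ChartedSpace EF F]
  [TopologicalSpace N] [ChartedSpace EN N]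
  [TopologicalSpace P] [ChartedSpace EP P] [IsManifold 𝓘(ℝ, EP) ∞ P]
  [Group G] [MulAction Gᵐᵒᵖ P] {π : P → M} {ν : N → M} {ρ : N → TangentBundle 𝓘(ℝ, EM) M}
  {h : P × N → TangentBundle 𝓘(ℝ, EP) P}

/-- The section is the one with constant fibre coordinate, that of `n`, in a local trivialization.
-/
theorem IsFibreBundle.exists_isLocalSection
    (hν : IsFibreBundle 𝓘(ℝ, EM) 𝓘(ℝ, EF) 𝓘(ℝ, EN) F ν) (n : N) :
    ∃ (U : Set M) (s : M → N), IsLocalSection 𝓘(ℝ, EM) 𝓘(ℝ, EN) ν univ U s ∧ ν n ∈ U ∧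
      s (ν n) = n := by
  obtain ⟨e, hn, he⟩ := hν.exists_trivialization (ν n)
  refine ⟨e.baseSet, fun x => e.toOpenPartialHomeomorph.symm (x, (e n).2),
    ⟨e.open_baseSet, ?_, fun _ _ => mem_univ _, fun x hx => e.proj_symm_apply' hx⟩, hn,
    e.symm_apply_mk_proj (e.mem_source.2 hn)⟩
  exact he.2.comp (contMDiffOn_id.prodMk contMDiffOn_const) fun x hx => e.mem_target.2 hx

/-- The lifts of the local sections of `ν` generate the distribution of the anchored bundle. -/
theorem IsPrincipalLift.generates (hν : IsFibreBundle 𝓘(ℝ, EM) 𝓘(ℝ, EF) 𝓘(ℝ, EN) F ν)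
    (hπ : ContMDiff 𝓘(ℝ, EP) 𝓘(ℝ, EM) ∞ π)
    (hh : IsPrincipalLift 𝓘(ℝ, EM) 𝓘(ℝ, EN) 𝓘(ℝ, EP) G π ν ρ h) :
    Generates 𝓘(ℝ, EP) (liftedFields 𝓘(ℝ, EM) 𝓘(ℝ, EN) 𝓘(ℝ, EP) π ν h)
      (generatedDistribution 𝓘(ℝ, EP)
        (anchoredFields 𝓘(ℝ, EP) (𝓘(ℝ, EP).prod 𝓘(ℝ, EN)) Prod.fst (fibreProduct π ν) h)) where
  isLocalField := by
    rintro _ ⟨U, s, hs, rfl⟩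
    have hmem : ∀ u ∈ π ⁻¹' U, (u, s (π u)) ∈ fibreProduct π ν := fun u hu => (hs.proj _ hu).symm
    exact ⟨hπ.continuous.isOpen_preimage _ hs.isOpen, hh.contMDiffOn.comp
      (contMDiffOn_id.prodMk (hs.contMDiffOn.comp hπ.contMDiffOn fun u hu => hu)) hmem,
      fun u hu => hh.proj _ (hmem u hu)⟩
  everywhere u := by
    obtain ⟨n, hn⟩ := hν.surjective (π u)
    obtain ⟨U, s, hs, hU, -⟩ := hν.exists_isLocalSection n
    exact ⟨_, ⟨U, s, hs, rfl⟩, by rwa [hn] at hU⟩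
  eq_span := by
    funext u
    refine congrArg (Submodule.span ℝ) (Set.ext fun v => ⟨?_, ?_⟩)
    · rintro ⟨⟨V, X⟩, ⟨σ, hσ, rfl : X = _⟩, hu, hv⟩
      have hσu : (σ u).1 = u := hσ.proj u hu
      have hσm : π (σ u).1 = ν (σ u).2 := hσ.mem u hu
      obtain ⟨U, s, hs, hU, hsn⟩ := hν.exists_isLocalSection (σ u).2
      -- The section `s` through `(σ u).2` need not be related to `σ` elsewhere: the spans compare
      -- values at the single point `u`.
      rw [← hσm, hσu] at hU hsn
      refine ⟨_, ⟨U, s, hs, rfl⟩, hU, ?_⟩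
      change h (u, s (π u)) = _
      rw [hsn, ← hv]
      exact congrArg h (Prod.ext hσu.symm rfl)
    · rintro ⟨_, ⟨U, s, hs, rfl⟩, hu, hv⟩
      refine ⟨(π ⁻¹' U, fun u => h (u, s (π u))), ⟨fun u => (u, s (π u)), ⟨?_, ?_, ?_, ?_⟩, rfl⟩,
        hu, hv⟩
      · exact hπ.continuous.isOpen_preimage _ hs.isOpen
      · exact contMDiffOn_id.prodMk (hs.contMDiffOn.comp hπ.contMDiffOn fun u hu => hu)
      · exact fun u hu => (hs.proj _ hu).symm
      · exact fun u _ => rfl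

end Distribution

end AnchoredLift

open AnchoredLift in
theorem mainTheorem7
    {EM EF EN EP EG : Type*}
    [NormedAddCommGroup EM] [NormedSpace ℝ EM] [FiniteDimensional ℝ EM]
    [NormedAddCommGroup EF] [NormedSpace ℝ EF] [FiniteDimensional ℝ EF]
    [NormedAddCommGroup EN] [NormedSpace ℝ EN] [FiniteDimensional ℝ EN]
    [NormedAddCommGroup EP] [NormedSpace ℝ EP] [FiniteDimensional ℝ EP]
    [NormedAddCommGroup EG] [NormedSpace ℝ EG] [FiniteDimensional ℝ EG]
    {M F N P G : Type*}
    [TopologicalSpace M] [T2Space M] [ChartedSpace EM M] [IsManifold 𝓘(ℝ, EM) ∞ M]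
    [TopologicalSpace F] [T2Space F] [ChartedSpace EF F] [IsManifold 𝓘(ℝ, EF) ∞ F]
    [TopologicalSpace N] [T2Space N] [ChartedSpace EN N] [IsManifold 𝓘(ℝ, EN) ∞ N]
    [TopologicalSpace P] [T2Space P] [ChartedSpace EP P] [IsManifold 𝓘(ℝ, EP) ∞ P]
    [TopologicalSpace G] [T2Space G] [ChartedSpace EG G] [Group G] [LieGroup 𝓘(ℝ, EG) ∞ G]
    [MulAction Gᵐᵒᵖ P]
    (ν : N → M) (hν : IsFibreBundle 𝓘(ℝ, EM) 𝓘(ℝ, EF) 𝓘(ℝ, EN) F ν)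
    (ρ : N → TangentBundle 𝓘(ℝ, EM) M) (hρ : IsAnchor 𝓘(ℝ, EM) 𝓘(ℝ, EN) ν ρ)
    (π : P → M) (hπ : IsPrincipalBundle 𝓘(ℝ, EM) 𝓘(ℝ, EP) 𝓘(ℝ, EG) G π)
    (h : P × N → TangentBundle 𝓘(ℝ, EP) P)
    (hh : IsPrincipalLift 𝓘(ℝ, EM) 𝓘(ℝ, EN) 𝓘(ℝ, EP) G π ν ρ h) :
    -- the lifted sections generate the distribution `Q` of the anchored bundle `(π^*N, h)`,
    -- and hence the smallest completely integrable distribution containing `Q`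
    (Generates 𝓘(ℝ, EP) (liftedFields 𝓘(ℝ, EM) 𝓘(ℝ, EN) 𝓘(ℝ, EP) π ν h)
        (generatedDistribution 𝓘(ℝ, EP)
          (anchoredFields 𝓘(ℝ, EP) (𝓘(ℝ, EP).prod 𝓘(ℝ, EN)) Prod.fst (fibreProduct π ν) h)) ∧
      ∀ D : ∀ u : P, Submodule ℝ (TangentSpace 𝓘(ℝ, EP) u),
        IsSmallestIntegrable 𝓘(ℝ, EP)
          (generatedDistribution 𝓘(ℝ, EP)
            (anchoredFields 𝓘(ℝ, EP) (𝓘(ℝ, EP).prod 𝓘(ℝ, EN)) Prod.fst (fibreProduct π ν) h)) D ↔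
        IsSmallestIntegrable 𝓘(ℝ, EP)
          (generatedDistribution 𝓘(ℝ, EP)
            (liftedFields 𝓘(ℝ, EM) 𝓘(ℝ, EN) 𝓘(ℝ, EP) π ν h)) D) ∧
    -- `h`-admissible curves project onto `ρ`-admissible curves
    (∀ (a b : ℝ) (e : ℝ → P × N),
      IsAdmissible 𝓘(ℝ, EP) (𝓘(ℝ, EP).prod 𝓘(ℝ, EN)) Prod.fst (fibreProduct π ν) h a b e →
      IsAdmissible 𝓘(ℝ, EM) 𝓘(ℝ, EN) ν univ ρ a b (fun t => (e t).2)) ∧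
    -- existence and uniqueness of the `h`-admissible curve over `c` through `u`
    (∀ (a b : ℝ) (c : ℝ → N) (u : P),
      IsAdmissible 𝓘(ℝ, EM) 𝓘(ℝ, EN) ν univ ρ a b c → π u = ν (c a) →
      ∃ e : ℝ → P × N,
        (IsAdmissible 𝓘(ℝ, EP) (𝓘(ℝ, EP).prod 𝓘(ℝ, EN)) Prod.fst (fibreProduct π ν) h a b e ∧
          (∀ t ∈ Icc a b, (e t).2 = c t) ∧ (e a).1 = u) ∧
        (∀ e' : ℝ → P × N,
          IsAdmissible 𝓘(ℝ, EP) (𝓘(ℝ, EP).prod 𝓘(ℝ, EN)) Prod.fst (fibreProduct π ν) h a b e' →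
          (∀ t ∈ Icc a b, (e' t).2 = c t) → (e' a).1 = u → EqOn e' e (Icc a b)) ∧
        -- its construction from an arbitrary principal connection
        (∀ θ : TangentBundle 𝓘(ℝ, EP) P → EG,
          IsConnectionForm (G := G) 𝓘(ℝ, EP) 𝓘(ℝ, EG) θ →
          ∃ d : ℝ → P,
            (IsHorizontalLift 𝓘(ℝ, EP) θ π (fun t => ν (c t)) a b d ∧ d a = u) ∧
            (∀ d' : ℝ → P, IsHorizontalLift 𝓘(ℝ, EP) θ π (fun t => ν (c t)) a b d' → d' a = u →
              EqOn d' d (Icc a b)) ∧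
            ∃ g : ℝ → G,
              (IsRightLogarithmicSolution 𝓘(ℝ, EG) (fun t => θ (h (d t, c t))) a b g ∧
                g a = 1) ∧
              (∀ g' : ℝ → G,
                IsRightLogarithmicSolution 𝓘(ℝ, EG) (fun t => θ (h (d t, c t))) a b g' →
                g' a = 1 → EqOn g' g (Icc a b)) ∧
              EqOn e (fun t => (d t <• g t, c t)) (Icc a b))) := by
  have : CompleteSpace EG := FiniteDimensional.complete ℝ EG
  have hgen := hh.generates hν hπ.contMDiff
  refine ⟨⟨hgen, fun D => by rw [hgen.eq_span]⟩, fun a b e he => ?_, fun a b c u hc hu => ?_⟩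
  · exact he.map contMDiff_fst hπ.contMDiff contMDiff_snd (fun _ _ => mem_univ _)
      (fun p hp => hp.symm) fun p hp => (hh.tangentMap_proj p hp).symm
  · obtain ⟨p, hp, hpa⟩ := hh.exists_isAdmissible hπ hν.contMDiff hc u hu
    refine ⟨fun t => (p t, c t), ⟨hp, fun _ _ => rfl, hpa⟩,
      fun e' he' he'2 he'a => hh.eqOn hπ hp he' he'2 (he'a.trans hpa.symm), fun θ hθ => ?_⟩
    obtain ⟨d, g, hd, hda, hg, hga, hdg⟩ :=
      hh.exists_horizontal_isAdmissible hπ hν.contMDiff hc hθ u 1 hu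
    refine ⟨d, ⟨hd, hda⟩, fun d' hd' hd'a => hθ.eqOn hπ hd hd' (hd'a.trans hda.symm), g, ⟨hg, hga⟩,
      fun g' hg' hg'a => hg.eqOn hg' (hg'a.trans hga.symm), ?_⟩
    -- `d <• g` is also a lift of `c` from `u`, since `g a = 1`; uniqueness identifies it with the
    -- lift chosen before `θ`.
    refine hh.eqOn hπ hdg hp (fun _ _ => rfl) ?_
    simp only [hda, hga, act_one, hpa]
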